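/- **Conventions.** For $x\in\mathbb{R}^n$ and $r>0$ let $Q(x,r)=\{y\in\mathbb{R}^n: \max_i|y_i-x_i|\le r\}$. Let $\mathcal{P}_{k-1}$ be the space of real polynomials on $\mathbb{R}^n$ of degree at most $k-1$, and let $\mathcal{H}^d$ be the $d$-dimensional Hausdorff measure. A closed set $S\subset\mathbb{R}^n$ is a *$d$-set* ($0<d\le n$) if there are $c_1,c_2>0$ with $c_1r^d\le\mathcal{H}^d(Q(w,r)\cap S)\le c_2r^d$ for all $w\in S$ and $0<r\le1$; $L^p(S)$ is taken with respect to $\mathcal{H}^d|_S$. All functions are real-valued. Put $$\mathcal{E}_k(f,Q)_{L^1(\mathbb{R}^n)}=\inf_{P\in\mathcal{P}_{k-1}}\frac1{|Q|}\int_Q|f-P|\,dx,\qquad \mathcal{E}_k(h,Q)_{L^1(S)}=\inf_{P\in\mathcal{P}_{k-1}}\frac1{\mathcal{H}^d(Q\cap S)}\int_{Q\cap S}|h-P|\,d\mathcal{H}^d .$$ Let $\alpha>0$, $1<p<\infty$, $1\le q\le\infty$, and fix an integer $m>\alpha$. The space $F^\alpha_{pq}(\mathbb{R}^n)$ consists of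 the $f\in L^p(\mathbb{R}^n)$ for which $$g(x)=\Big(\int_0^1\big(t^{-\alpha}\mathcal{E}_m(f,Q(x,t))_{L^1(\mathbb{R}^n)}\big)^q\,\frac{dt}{t}\Big)^{1/q}\quad\Big(g(x)=\sup_{0<t\le1}t^{-\alpha}\mathcal{E}_m(f,Q(x,t))_{L^1(\mathbb{R}^n)}\text{ if }q=\infty\Big)$$ is in $L^p(\mathbb{R}^n)$, with norm $\|f\|_{F^\alpha_{pq}(\mathbb{R}^n)}=\|f\|_{L^p(\mathbb{R}^n)}+\|g\|_{L^p(\mathbb{R}^n)}$. The trace of $f$ is $f|_S(x)=\lim_{r\to0+}\frac1{|Q(x,r)|}\int_{Q(x,r)}f(y)\,dy$ at those $x\in S$ where the limit exists. **Theorem.** Let $S\subset\mathbb{R}^n$ be a $d$-set with $n-1<d<n$. Let $1<p<\infty$, $\alpha>(n-d)/p$, and let $m>\alpha$ be the integer used to define the norm of $F^\alpha_{pq}(\mathbb{R}^n)$. Then there is a constant $c$, depending only on $n$, $S$, $p$, $\alpha$ (and on the choice $m$ of the norm), such that for all $1\le q\le\infty$, all integers $k>\alpha$ and all $f\in F^\alpha_{pq}(\mathbb{R}^n)$,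 the trace $f|_S$ exists $\mathcal{H}^d$-almost everywhere on $S$, belongs to $L^p(S)$, and $$\bigg(\sum_{i=0}^\infty\Big(2^{i(\alpha-(n-d)/p)}\big\|\mathcal{E}_k(f|_S,Q(\cdot,2^{-i}))_{L^1(S)}\big\|_{L^p(S)}\Big)^p\bigg)^{1/p}+\|f|_S\|_{L^p(S)}\le c\,\|f\|_{F^\alpha_{pq}(\mathbb{R}^n)} .$$ -/

import Mathlib

open MeasureTheory Set Filter Topology
open scoped ENNReal NNReal

noncomputable section

namespace TraceDSet

/-- `ℝⁿ`, with the Euclidean metric (used by the Hausdorff measure) and Lebesgue measure. -/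
abbrev E (n : ℕ) : Type := EuclideanSpace ℝ (Fin n)

/-- The closed cube `Q(x, r)` with centre `x`, side length `2 r` and sides parallel to the axes. -/
def cube {n : ℕ} (x : E n) (r : ℝ) : Set (E n) := {y | ∀ i, |y i - x i| ≤ r}

/-- `S` is a `d`-set (Ahlfors `d`-regular): `0 < d ≤ n`, `S` is closed, and
`c₁ r ^ d ≤ ℋᵈ(Q(w, r) ∩ S) ≤ c₂ r ^ d` for all `w ∈ S` and `0 < r ≤ 1`. -/
def IsDSet {n : ℕ} (d : ℝ) (S : Set (E n)) : Prop :=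
  0 < d ∧ d ≤ n ∧ IsClosed S ∧
    ∃ c₁ c₂ : ℝ, 0 < c₁ ∧ 0 < c₂ ∧ ∀ w ∈ S, ∀ r : ℝ, 0 < r → r ≤ 1 →
      ENNReal.ofReal (c₁ * r ^ d) ≤ (μH[d] : Measure (E n)) (cube w r ∩ S) ∧
      (μH[d] : Measure (E n)) (cube w r ∩ S) ≤ ENNReal.ofReal (c₂ * r ^ d)

/-- The natural measure `ℋᵈ|_S` on `S`. -/
def measureOn {n : ℕ} (d : ℝ) (S : Set (E n)) : Measure (E n) :=
  (μH[d] : Measure (E n)).restrict S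

/-- Polynomials on `ℝⁿ` of degree at most `k - 1`; only the zero polynomial if `k = 0`. -/
def polysBelow (n k : ℕ) : Set (MvPolynomial (Fin n) ℝ) := {P | P = 0 ∨ P.totalDegree < k}

/-- The normalized local best approximation of order `k` in `L¹(μ)` on the cube `Q(x, r)`:
the infimum over polynomials `P` of degree at most `k - 1` of the mean value of `|f - P|`
over `Q(x, r)` with respect to `μ`. For `μ = volume` this is the quantity on `ℝⁿ`, for
`μ = measureOn d S` the mean is taken over `Q(x, r) ∩ S` with respect to `ℋᵈ`. -/
def localApprox {n : ℕ} (μ : Measure (E n)) (k : ℕ) (f : E n → ℝ) (x : E n) (r : ℝ) : ℝ≥0∞ :=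
  ⨅ P ∈ polysBelow n k,
    ⨍⁻ y in cube x r, ENNReal.ofReal |f y - MvPolynomial.eval (fun i => y i) P| ∂μ

/-- The function `g` in the definition of the Triebel-Lizorkin space, with approximation
order `m`: `g(x) = (∫₀¹ (t ^ (-α) E_m(f, Q(x, t))) ^ q dt / t) ^ (1 / q)` for `q < ∞`, and
`g(x) = sup_{0 < t ≤ 1} t ^ (-α) E_m(f, Q(x, t))` for `q = ∞`. -/
def smoothnessFn {n : ℕ} (m : ℕ) (α : ℝ) (q : ℝ≥0∞) (f : E n → ℝ) (x : E n) : ℝ≥0∞ :=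
  if q = ∞ then
    ⨆ t ∈ Ioc (0 : ℝ) 1, ENNReal.ofReal (t ^ (-α)) * localApprox volume m f x t
  else
    (∫⁻ t in Ioc (0 : ℝ) 1,
      (ENNReal.ofReal (t ^ (-α)) * localApprox volume m f x t) ^ q.toReal
        / ENNReal.ofReal t) ^ (1 / q.toReal)

/-- `f ∈ F^α_{pq}(ℝⁿ)`: both `f` and `g` are in `L^p(ℝⁿ)`. -/
def MemTriebelLizorkin {n : ℕ} (m : ℕ) (α p : ℝ) (q : ℝ≥0∞) (f : E n → ℝ) : Prop :=
  MemLp f (ENNReal.ofReal p) volume ∧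
    MemLp (smoothnessFn m α q f) (ENNReal.ofReal p) volume

/-- The Triebel-Lizorkin norm `‖f‖_{L^p(ℝⁿ)} + ‖g‖_{L^p(ℝⁿ)}`. -/
def triebelLizorkinNorm {n : ℕ} (m : ℕ) (α p : ℝ) (q : ℝ≥0∞) (f : E n → ℝ) : ℝ≥0∞ :=
  eLpNorm f (ENNReal.ofReal p) volume +
    eLpNorm (smoothnessFn m α q f) (ENNReal.ofReal p) volume

/-- `f` is strictly defined at `x`: the means of `f` over the cubes `Q(x, r)` converge
as `r → 0+`. -/
def StrictlyDefinedAt {n : ℕ} (f : E n → ℝ) (x : E n) : Prop :=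
  ∃ l : ℝ, Tendsto (fun r : ℝ => ⨍ y in cube x r, f y) (𝓝[>] 0) (𝓝 l)

/-- The pointwise trace: the limit of the means of `f` over `Q(x, r)` as `r → 0+`. It is
meaningful at the points where `f` is strictly defined. -/
def trace {n : ℕ} (f : E n → ℝ) (x : E n) : ℝ :=
  limUnder (𝓝[>] (0 : ℝ)) (fun r : ℝ => ⨍ y in cube x r, f y)

end TraceDSet

end

/-!
# Traces of Triebel–Lizorkin spaces on `d`-sets

Write `E_k(f, Q)` for the local approximation of order `k`. The exponent `q` is removed at once:
`E_m(f, Q(x, t))` is at most `2 ^ n E_m(f, Q(x, s))` for `t ≤ s ≤ 2 t`, so the smoothness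
function for any `q ≥ 1` dominates a fixed multiple of `t ^ (-α) E_m(f, Q(x, t))` for all
`t ≤ 1 / 2` (`rpow_mul_localApprox_le_smoothnessFn`). A Marchaud-type argument, which replaces polynomials of
degree less than `m` by their truncations, lowers the order from `m` to any `k > a` with `a ≤ α`, at
the price of a local mass of `|f|` (`exists_localApprox_le_majorant`). Thus there is a single
function `H = majorant m α q f`, with `L^p` norm at most a constant times the norm of `f`, such that
`E_k(f, Q(x, t)) ≤ C t ^ a H(x)` for `t ≤ 4`.

The passage from `ℝⁿ` to `S` uses that `S` is porous, because `d < n`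
(`IsRegular.exists_porosity`). For `y ∈ S` the approximation `E_k(f, Q(y, 2 ^ (1 - j)))` is bounded by
a multiple of `2 ^ (- j a) H(z)` for every `z` in `Q(y, 2 ^ (- j - 1))`, hence by an `L^p` mean of `2 ^ (- j a) H`
over the part of that cube at distance about `2 ^ (-j)` from `S` (`awayMean`,
`rpow_le_awayMean`). For different `j` these parts overlap boundedly, and Tonelli's theorem gives
`∑ⱼ 2 ^ (j (a p - (n - d))) ∫_S E_k(f, Q(y, 2 ^ (1 - j))) ^ p ≤ C ∫ H ^ p`
(`IsRegular.tsum_lintegral_awayMean_le`). This is why the trace space does not depend on `q`.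

At a point `y` of `S` at which the approximations by constants are summable over the dyadic scales
the means of `f` converge. As `(n - d) / p < 1`, the previous estimate with `k = 1` shows that this
happens almost everywhere (`IsRegular.ae_strictlyDefinedAt`). For general `k`, a fixed linear
combination of means over concentric cubes reproduces polynomials of degree less than `k` and still
converges to the trace. So the trace differs from a polynomial `P` at `y` by at most
a constant times the mean of `|f - P|` over `Q(y, 2 ^ (-i))` plus `∑_{j ≥ i} E_k(f, Q(y, 2 ^ (-j)))`
(`exists_sub_eval_le`). Averaging over a cube intersected with `S` bounds the approximations of the
trace on `S` by these tails, and a discrete Hardy inequality (`exists_hardy`) sums them.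
-/

noncomputable section

namespace TraceDSet

/-! ### Cubes -/

section Cubes

variable {n : ℕ}

lemma mem_cube {x y : E n} {r : ℝ} : y ∈ cube x r ↔ ∀ i, |y i - x i| ≤ r := Iff.rfl

lemma mem_cube_comm {x y : E n} {r : ℝ} : y ∈ cube x r ↔ x ∈ cube y r := by
  simp only [mem_cube, abs_sub_comm]

lemma mem_cube_trans {x y z : E n} {r s t : ℝ} (h : y ∈ cube x r) (h' : z ∈ cube y s)
    (hrs : r + s ≤ t) : z ∈ cube x t := by
  intro i
  have := abs_sub_le (z i) (y i) (x i)
  linarith [h i, h' i]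

lemma cube_subset_cube {x y : E n} {r s t : ℝ} (h : y ∈ cube x r) (hrs : r + s ≤ t) :
    cube y s ⊆ cube x t := fun _ hz => mem_cube_trans h hz hrs

lemma cube_mono (x : E n) {r s : ℝ} (h : r ≤ s) : cube x r ⊆ cube x s :=
  fun _ hz i => (hz i).trans h

lemma isClosed_cube_prod (r : ℝ) : IsClosed {z : E n × E n | z.2 ∈ cube z.1 r} := by
  simp only [mem_cube, Set.ofPred_forall]
  exact isClosed_iInter fun i => isClosed_le (by fun_prop) (by fun_prop)

lemma measurableSet_cube_prod (r : ℝ) : MeasurableSet {z : E n × E n | z.2 ∈ cube z.1 r} :=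
  (isClosed_cube_prod r).measurableSet

lemma isClosed_cube (x : E n) (r : ℝ) : IsClosed (cube x r) :=
  (isClosed_cube_prod r).preimage (Continuous.prodMk_right x)

lemma measurableSet_cube (x : E n) (r : ℝ) : MeasurableSet (cube x r) :=
  (isClosed_cube x r).measurableSet

lemma cube_eq_preimage (x : E n) (r : ℝ) :
    cube x r = (WithLp.ofLp : E n → Fin n → ℝ) ⁻¹' Icc (fun i => x i - r) (fun i => x i + r) := by
  ext y
  simp only [mem_cube, mem_preimage, mem_Icc, Pi.le_def, abs_le, ← forall_and]
  exact forall_congr' fun i => by constructor <;> rintro ⟨_, _⟩ <;> constructor <;> linarith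

lemma volume_cube (x : E n) (r : ℝ) : volume (cube x r) = ENNReal.ofReal (2 * r) ^ n := by
  rw [cube_eq_preimage, (PiLp.volume_preserving_ofLp (Fin n)).measure_preimage
    measurableSet_Icc.nullMeasurableSet, Real.volume_Icc_pi]
  simp only [add_sub_sub_cancel, Finset.prod_const, Finset.card_univ, Fintype.card_fin, two_mul]

lemma volume_cube_ne_zero (x : E n) {r : ℝ} (hr : 0 < r) : volume (cube x r) ≠ 0 := by
  rw [volume_cube]; exact pow_ne_zero _ (by simpa using hr)

lemma volume_cube_ne_top (x : E n) (r : ℝ) : volume (cube x r) ≠ ∞ := by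
  rw [volume_cube]; exact ENNReal.pow_ne_top ENNReal.ofReal_ne_top

lemma setLAverage_cube_eq (f : E n → ℝ≥0∞) (x : E n) (r : ℝ) :
    ⨍⁻ y in cube x r, f y ∂volume = (volume (cube x r))⁻¹ * ∫⁻ y in cube x r, f y := by
  rw [setLAverage_eq, ENNReal.div_eq_inv_mul]

/-- Passing from a cube to a larger cube costs at most the ratio of the volumes. -/
lemma setLAverage_cube_le (f : E n → ℝ≥0∞) {x y : E n} {s t : ℝ} (hs : 0 < s) (ht : 0 < t)
    (h : cube y s ⊆ cube x t) :
    ⨍⁻ z in cube y s, f z ∂volume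
      ≤ ENNReal.ofReal (t / s) ^ n * ⨍⁻ z in cube x t, f z ∂volume := by
  rw [setLAverage_cube_eq, setLAverage_cube_eq, ← mul_assoc]
  refine mul_le_mul' (le_of_eq ?_) (lintegral_mono_set h)
  have : volume (cube x t) = ENNReal.ofReal (t / s) ^ n * volume (cube y s) := by
    rw [volume_cube, volume_cube, ← mul_pow, ← ENNReal.ofReal_mul (by positivity)]
    congr 2; field_simp
  rw [this, ENNReal.mul_inv (Or.inr (volume_cube_ne_top _ _)) (Or.inr (volume_cube_ne_zero _ hs)),
    ← mul_assoc, ENNReal.mul_inv_cancel, one_mul]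
  · exact pow_ne_zero _ (by simp; positivity)
  · exact ENNReal.pow_ne_top ENNReal.ofReal_ne_top

/-- The normalised Lebesgue measure on a cube. -/
def cubeProb (x : E n) (r : ℝ) : Measure (E n) :=
  (volume (cube x r))⁻¹ • volume.restrict (cube x r)

lemma setLAverage_cube (f : E n → ℝ≥0∞) (x : E n) (r : ℝ) :
    ⨍⁻ y in cube x r, f y ∂volume = ∫⁻ y, f y ∂(cubeProb x r) := by
  rw [laverage, cubeProb, Measure.restrict_apply_univ]

lemma setAverage_cube (f : E n → ℝ) (x : E n) (r : ℝ) :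
    ⨍ y in cube x r, f y = ∫ y, f y ∂(cubeProb x r) := by
  rw [average, cubeProb, Measure.restrict_apply_univ]

lemma isProbabilityMeasure_cubeProb (x : E n) {r : ℝ} (hr : 0 < r) :
    IsProbabilityMeasure (cubeProb x r) := by
  constructor
  rw [cubeProb, Measure.smul_apply, Measure.restrict_apply_univ, smul_eq_mul,
    ENNReal.inv_mul_cancel (volume_cube_ne_zero x hr) (volume_cube_ne_top x r)]

lemma cubeProb_absolutelyContinuous (x : E n) (r : ℝ) : cubeProb x r ≪ volume :=
  Measure.absolutelyContinuous_of_le_smul (c := (volume (cube x r))⁻¹) <| by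
    rw [cubeProb]; gcongr; exact Measure.restrict_le_self

lemma measurableEmbedding_affine (x : E n) {ρ : ℝ} (hρ : 0 < ρ) :
    MeasurableEmbedding fun u : E n => x + ρ • u :=
  ((Homeomorph.smulOfNeZero ρ hρ.ne').trans (Homeomorph.addLeft x)).measurableEmbedding

lemma affine_mem_cube {x u : E n} {ρ s : ℝ} (hρ : 0 < ρ) :
    x + ρ • u ∈ cube x (ρ * s) ↔ u ∈ cube 0 s := by
  simp only [mem_cube, PiLp.add_apply, PiLp.smul_apply, PiLp.zero_apply, smul_eq_mul,
    add_sub_cancel_left, sub_zero, abs_mul, abs_of_pos hρ, mul_le_mul_iff_right₀ hρ]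

lemma map_affine_cubeProb (x : E n) {ρ : ℝ} (hρ : 0 < ρ) {s : ℝ} (hs : 0 < s) :
    (cubeProb 0 s).map (fun u => x + ρ • u) = cubeProb x (ρ * s) := by
  have hpre : (fun u : E n => x + ρ • u) ⁻¹' cube x (ρ * s) = cube 0 s := by
    ext u; exact affine_mem_cube hρ
  have hmap : (volume : Measure (E n)).map (fun u => x + ρ • u)
      = ENNReal.ofReal (ρ ^ n)⁻¹ • volume := by
    have h1 : (fun u : E n => x + ρ • u) = (fun u => x + u) ∘ (fun u => ρ • u) := rfl
    rw [h1, ← Measure.map_map (by fun_prop) (by fun_prop), Measure.map_addHaar_smul _ hρ.ne',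
      Measure.map_smul, map_add_left_eq_self]
    simp [abs_of_pos (pow_pos hρ n)]
  rw [cubeProb, cubeProb, Measure.map_smul, ← hpre,
    ← (measurableEmbedding_affine x hρ).restrict_map, hpre, hmap, Measure.restrict_smul,
    smul_smul]
  congr 1
  rw [volume_cube, volume_cube, ← ENNReal.ofReal_pow (by positivity),
    ← ENNReal.ofReal_pow (by positivity), ← ENNReal.ofReal_inv_of_pos (by positivity),
    ← ENNReal.ofReal_inv_of_pos (by positivity), ← ENNReal.ofReal_mul (by positivity)]
  congr 1
  field_simp
  ring

lemma setLAverage_affine (f : E n → ℝ≥0∞) (x : E n) {ρ s : ℝ} (hρ : 0 < ρ) (hs : 0 < s) :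
    ⨍⁻ y in cube x (ρ * s), f y ∂volume = ⨍⁻ u in cube 0 s, f (x + ρ • u) ∂volume := by
  rw [setLAverage_cube, setLAverage_cube, ← map_affine_cubeProb x hρ hs,
    (measurableEmbedding_affine x hρ).lintegral_map]

lemma setAverage_affine (f : E n → ℝ) (x : E n) {ρ s : ℝ} (hρ : 0 < ρ) (hs : 0 < s) :
    ⨍ y in cube x (ρ * s), f y = ⨍ u in cube 0 s, f (x + ρ • u) := by
  rw [setAverage_cube, setAverage_cube, ← map_affine_cubeProb x hρ hs,
    (measurableEmbedding_affine x hρ).integral_map]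

lemma isCompact_cube (x : E n) (r : ℝ) : IsCompact (cube x r) := by
  rw [cube_eq_preimage]
  exact (PiLp.homeomorph 2 (fun _ : Fin n => ℝ)).isCompact_preimage.2 isCompact_Icc

lemma integrable_cubeProb {f : E n → ℝ} (hf : LocallyIntegrable f volume) (x : E n) {r : ℝ}
    (hr : 0 < r) : Integrable f (cubeProb x r) :=
  (hf.integrableOn_isCompact (isCompact_cube x r)).smul_measure
    (ENNReal.inv_ne_top.2 (volume_cube_ne_zero x hr))

/-- The integral over a moving cube is a measurable function of its centre. -/
lemma measurable_setLIntegral_cube {ν : Measure (E n)} [SFinite ν] {f : E n → ℝ≥0∞}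
    (hf : Measurable f) (r : ℝ) : Measurable fun x => ∫⁻ y in cube x r, f y ∂ν := by
  have h : ∀ x, ∫⁻ y in cube x r, f y ∂ν
      = ∫⁻ y, ({z : E n × E n | z.2 ∈ cube z.1 r}.indicator (fun z => f z.2)) (x, y) ∂ν := by
    intro x
    rw [← lintegral_indicator (measurableSet_cube x r)]
    rfl
  simp only [h]
  exact (Measurable.indicator (by fun_prop) (measurableSet_cube_prod r)).lintegral_prod_right'

lemma measurable_measure_cube (ν : Measure (E n)) [SFinite ν] (r : ℝ) :
    Measurable fun x => ν (cube x r) := by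
  simpa using measurable_setLIntegral_cube (ν := ν) (f := fun _ => 1) measurable_const r

/-- Tonelli's theorem for integrals over moving cubes: `y ∈ Q(x, r)` is a symmetric relation. -/
lemma lintegral_setLIntegral_cube {μ ν : Measure (E n)} [SFinite μ] [SFinite ν] {f : E n → ℝ≥0∞}
    (hf : Measurable f) (r : ℝ) :
    ∫⁻ x, ∫⁻ y in cube x r, f y ∂ν ∂μ = ∫⁻ y, f y * μ (cube y r) ∂ν := by
  have h : ∀ x, ∫⁻ y in cube x r, f y ∂ν
      = ∫⁻ y, ({z : E n × E n | z.2 ∈ cube z.1 r}.indicator (fun z => f z.2)) (x, y) ∂ν := by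
    intro x
    rw [← lintegral_indicator (measurableSet_cube x r)]
    rfl
  simp only [h]
  have hm : Measurable
      ({z : E n × E n | z.2 ∈ cube z.1 r}.indicator fun z : E n × E n => f z.2) :=
    Measurable.indicator (by fun_prop) (measurableSet_cube_prod r)
  rw [lintegral_lintegral_swap (f := fun x y =>
    {z : E n × E n | z.2 ∈ cube z.1 r}.indicator (fun z => f z.2) (x, y)) hm.aemeasurable]
  refine lintegral_congr fun y => ?_
  rw [← lintegral_indicator_const (measurableSet_cube y r)]
  refine lintegral_congr fun x => ?_
  have hxy : (x, y) ∈ {z : E n × E n | z.2 ∈ cube z.1 r} ↔ x ∈ cube y r := mem_cube_comm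
  by_cases hx : x ∈ cube y r
  · rw [indicator_of_mem hx, indicator_of_mem (hxy.2 hx)]
  · rw [indicator_of_notMem hx, indicator_of_notMem (mt hxy.1 hx)]

end Cubes

/-! ### Local polynomial approximation and the smoothness function -/

section LocalApprox

variable {n : ℕ}

lemma polysBelow_mono {k l : ℕ} (h : k ≤ l) : polysBelow n k ⊆ polysBelow n l :=
  fun _ hP => hP.imp id fun h' => h'.trans_le h

lemma zero_mem_polysBelow (k : ℕ) : (0 : MvPolynomial (Fin n) ℝ) ∈ polysBelow n k := Or.inl rfl

lemma localApprox_le {μ : Measure (E n)} {k : ℕ} {f : E n → ℝ} {x : E n} {r : ℝ}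
    {P : MvPolynomial (Fin n) ℝ} (hP : P ∈ polysBelow n k) :
    localApprox μ k f x r
      ≤ ⨍⁻ y in cube x r, ENNReal.ofReal |f y - MvPolynomial.eval (fun i => y i) P| ∂μ :=
  iInf₂_le P hP

lemma localApprox_antitone (μ : Measure (E n)) (f : E n → ℝ) (x : E n) (r : ℝ) {k l : ℕ}
    (h : k ≤ l) : localApprox μ l f x r ≤ localApprox μ k f x r :=
  le_iInf₂ fun _ hP => localApprox_le (polysBelow_mono h hP)

lemma localApprox_le_average (μ : Measure (E n)) (k : ℕ) (f : E n → ℝ) (x : E n) (r : ℝ) :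
    localApprox μ k f x r ≤ ⨍⁻ y in cube x r, ENNReal.ofReal |f y| ∂μ := by
  simpa using localApprox_le (f := f) (zero_mem_polysBelow k)

lemma le_mul_localApprox {μ : Measure (E n)} {k : ℕ} {f : E n → ℝ} {x : E n} {r : ℝ}
    {a c : ℝ≥0∞} (hc : c ≠ ∞)
    (h : ∀ P ∈ polysBelow n k,
      a ≤ c * ⨍⁻ y in cube x r, ENNReal.ofReal |f y - MvPolynomial.eval (fun i => y i) P| ∂μ) :
    a ≤ c * localApprox μ k f x r := by
  rcases eq_or_ne c 0 with rfl | hc0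
  · simpa using h 0 (zero_mem_polysBelow k)
  · simp only [localApprox, ENNReal.mul_iInf_of_ne hc0 hc]
    exact le_iInf₂ h

lemma localApprox_le_of_subset (k : ℕ) (f : E n → ℝ) {x y : E n} {s t : ℝ} (hs : 0 < s)
    (ht : 0 < t) (h : cube y s ⊆ cube x t) :
    localApprox volume k f y s ≤ ENNReal.ofReal (t / s) ^ n * localApprox volume k f x t := by
  refine le_mul_localApprox (ENNReal.pow_ne_top ENNReal.ofReal_ne_top) fun P hP => ?_
  exact (localApprox_le hP).trans (setLAverage_cube_le _ hs ht h)

/-- Substituting polynomials of degree at most one does not increase the total degree. -/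
lemma totalDegree_bind₁_le {σ τ : Type*} (g : σ → MvPolynomial τ ℝ)
    (hg : ∀ i, (g i).totalDegree ≤ 1) (P : MvPolynomial σ ℝ) :
    (MvPolynomial.bind₁ g P).totalDegree ≤ P.totalDegree := by
  conv_lhs => rw [P.as_sum, map_sum]
  refine MvPolynomial.totalDegree_finsetSum_le fun γ hγ => ?_
  rw [MvPolynomial.bind₁_monomial]
  refine (MvPolynomial.totalDegree_mul _ _).trans ?_
  rw [MvPolynomial.totalDegree_C, zero_add]
  refine (MvPolynomial.totalDegree_finsetProd _ _).trans ?_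
  refine le_trans (Finset.sum_le_sum fun i _ => ?_) (MvPolynomial.le_totalDegree hγ)
  exact (MvPolynomial.totalDegree_pow _ _).trans (by nlinarith [hg i, Nat.zero_le (γ i)])

lemma bind₁_mem_polysBelow {k : ℕ} (g : Fin n → MvPolynomial (Fin n) ℝ)
    (hg : ∀ i, (g i).totalDegree ≤ 1) {P : MvPolynomial (Fin n) ℝ} (hP : P ∈ polysBelow n k) :
    MvPolynomial.bind₁ g P ∈ polysBelow n k := by
  rcases hP with rfl | hP
  · left; simp
  · right; exact (totalDegree_bind₁_le g hg P).trans_lt hP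

/-- One half of the invariance `localApprox_affine` under affine changes of variables: a polynomial
competing for `f` becomes, after substitution, a competitor for `u ↦ f (x + ρ u)`. -/
lemma localApprox_affine_le (k : ℕ) (f : E n → ℝ) (x : E n) {ρ s : ℝ} (hρ : 0 < ρ) (hs : 0 < s) :
    localApprox volume k (fun u => f (x + ρ • u)) 0 s ≤ localApprox volume k f x (ρ * s) := by
  refine le_iInf₂ fun P hP => ?_
  let g : Fin n → MvPolynomial (Fin n) ℝ := fun i =>
    MvPolynomial.C (x i) + MvPolynomial.C ρ * MvPolynomial.X i
  have hg : ∀ i, (g i).totalDegree ≤ 1 := fun i => by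
    refine (MvPolynomial.totalDegree_add _ _).trans (max_le (by simp) ?_)
    refine (MvPolynomial.totalDegree_mul _ _).trans ?_
    simp
  refine (localApprox_le (bind₁_mem_polysBelow g hg hP)).trans (le_of_eq ?_)
  rw [setLAverage_affine _ x hρ hs]
  congr 1
  funext u
  rw [← MvPolynomial.coe_aeval_eq_eval, ← MvPolynomial.coe_aeval_eq_eval, RingHom.coe_coe,
    RingHom.coe_coe, MvPolynomial.aeval_bind₁]
  simp [g]

lemma localApprox_affine (k : ℕ) (f : E n → ℝ) (x : E n) {ρ s : ℝ} (hρ : 0 < ρ) (hs : 0 < s) :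
    localApprox volume k (fun u => f (x + ρ • u)) 0 s = localApprox volume k f x (ρ * s) := by
  refine le_antisymm (localApprox_affine_le k f x hρ hs) ?_
  refine le_iInf₂ fun P hP => ?_
  let g : Fin n → MvPolynomial (Fin n) ℝ := fun i =>
    MvPolynomial.C (-(ρ⁻¹ * x i)) + MvPolynomial.C ρ⁻¹ * MvPolynomial.X i
  have hg : ∀ i, (g i).totalDegree ≤ 1 := fun i => by
    refine (MvPolynomial.totalDegree_add _ _).trans
      (max_le ((MvPolynomial.totalDegree_C _).le.trans zero_le_one) ?_)
    refine (MvPolynomial.totalDegree_mul _ _).trans ?_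
    simp
  refine (localApprox_le (bind₁_mem_polysBelow g hg hP)).trans (le_of_eq ?_)
  rw [setLAverage_affine _ x hρ hs]
  congr 1
  funext u
  rw [← MvPolynomial.coe_aeval_eq_eval, ← MvPolynomial.coe_aeval_eq_eval, RingHom.coe_coe,
    RingHom.coe_coe, MvPolynomial.aeval_bind₁]
  have : ∀ i, -(ρ⁻¹ * x i) + ρ⁻¹ * (x i + ρ * u i) = u i := fun i => by field_simp; ring
  simp [g, this]

/-- The smoothness function controls the local approximation at every scale `t ≤ 1 / 2`, with a
constant that does not depend on the exponent `q`: approximation on `Q(x, t)` is dominated by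
approximation on `Q(x, s)` for `t ≤ s ≤ 2 t`. -/
lemma rpow_mul_localApprox_le_smoothnessFn (m : ℕ) {α : ℝ} (hα : 0 ≤ α) {q : ℝ≥0∞} (hq : 1 ≤ q)
    (f : E n → ℝ) (x : E n) {t : ℝ} (ht : 0 < t) (ht' : t ≤ 1 / 2) :
    ENNReal.ofReal (t ^ (-α)) * localApprox volume m f x t
      ≤ ENNReal.ofReal (2 ^ (α + n + 1)) * smoothnessFn m α q f x := by
  have hone : (1 : ℝ≥0∞) ≤ ENNReal.ofReal (2 ^ (α + n + 1)) := by
    rw [ENNReal.one_le_ofReal]; exact Real.one_le_rpow one_le_two (by positivity)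
  unfold smoothnessFn
  split_ifs with hqt
  · refine le_trans ?_ (le_mul_of_one_le_left zero_le hone)
    exact le_iSup₂_of_le (f := fun t (_ : t ∈ Ioc (0 : ℝ) 1) =>
      ENNReal.ofReal (t ^ (-α)) * localApprox volume m f x t) t ⟨ht, by linarith⟩ le_rfl
  have hq1 : 1 ≤ q.toReal := by
    simpa using (ENNReal.toReal_le_toReal ENNReal.one_ne_top hqt).2 hq
  set e := ENNReal.ofReal (t ^ (-α)) * localApprox volume m f x t with he
  set K : ℝ≥0∞ := ENNReal.ofReal (2 ^ (-(α + n))) with hK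
  have hKs : ∀ s ∈ Ioc t (2 * t),
      K * e ≤ ENNReal.ofReal (s ^ (-α)) * localApprox volume m f x s := by
    intro s hs
    have hs0 : 0 < s := ht.trans hs.1
    have h1 := localApprox_le_of_subset m f ht hs0 (cube_mono x hs.1.le)
    have h2 : ENNReal.ofReal (s / t) ^ n ≤ ENNReal.ofReal (2 ^ (n : ℝ)) := by
      rw [← ENNReal.ofReal_pow (by positivity), Real.rpow_natCast]
      gcongr
      rw [div_le_iff₀ ht]; exact hs.2
    have h3 : t ^ (-α) ≤ 2 ^ α * s ^ (-α) := by
      rw [Real.rpow_neg ht.le, Real.rpow_neg hs0.le, ← div_eq_mul_inv, inv_eq_one_div,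
        div_le_div_iff₀ (by positivity) (by positivity), one_mul, ← Real.mul_rpow (by simp) ht.le]
      exact Real.rpow_le_rpow hs0.le hs.2 hα
    calc K * e ≤ K * (ENNReal.ofReal (2 ^ α * s ^ (-α)) *
          (ENNReal.ofReal (2 ^ (n : ℝ)) * localApprox volume m f x s)) := by
          rw [he]; gcongr; exact h1.trans (by gcongr)
      _ = ENNReal.ofReal (2 ^ (-(α + n)) * 2 ^ α * 2 ^ (n : ℝ)) * (ENNReal.ofReal (s ^ (-α)) *
          localApprox volume m f x s) := by
          rw [hK, ENNReal.ofReal_mul (by positivity), ENNReal.ofReal_mul (by positivity),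
            ENNReal.ofReal_mul (by positivity)]
          ring
      _ = _ := by
          rw [← Real.rpow_add two_pos, ← Real.rpow_add two_pos]
          simp
  have hint : (K * e) ^ q.toReal * ENNReal.ofReal (1 / 2) ≤
      ∫⁻ s in Ioc (0 : ℝ) 1, (ENNReal.ofReal (s ^ (-α)) * localApprox volume m f x s) ^ q.toReal
        / ENNReal.ofReal s := by
    calc (K * e) ^ q.toReal * ENNReal.ofReal (1 / 2)
        = ∫⁻ s in Ioc t (2 * t), (K * e) ^ q.toReal / ENNReal.ofReal (2 * t) := by
          rw [setLIntegral_const, Real.volume_Ioc, ENNReal.div_eq_inv_mul, mul_comm _ ((K * e) ^ _),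
            mul_assoc, ← ENNReal.ofReal_inv_of_pos (by positivity),
            ← ENNReal.ofReal_mul (by positivity)]
          congr 2
          field_simp
          ring
      _ ≤ ∫⁻ s in Ioc t (2 * t), (ENNReal.ofReal (s ^ (-α)) *
            localApprox volume m f x s) ^ q.toReal / ENNReal.ofReal s := by
          refine setLIntegral_mono' measurableSet_Ioc fun s hs => ?_
          exact ENNReal.div_le_div (ENNReal.rpow_le_rpow (hKs s hs) (by positivity))
            (ENNReal.ofReal_le_ofReal hs.2)
      _ ≤ _ := lintegral_mono_set (Ioc_subset_Ioc ht.le (by linarith))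
  have hroot := ENNReal.rpow_le_rpow hint (z := 1 / q.toReal) (by positivity)
  rw [ENNReal.mul_rpow_of_nonneg _ _ (by positivity), ← ENNReal.rpow_mul,
    mul_one_div_cancel (by positivity), ENNReal.rpow_one] at hroot
  have hhalf : ENNReal.ofReal (1 / 2) ≤ ENNReal.ofReal (1 / 2) ^ (1 / q.toReal) := by
    conv_lhs => rw [← ENNReal.rpow_one (ENNReal.ofReal (1 / 2))]
    refine ENNReal.rpow_le_rpow_of_exponent_ge ?_ ?_
    · rw [ENNReal.ofReal_le_one]; norm_num
    · rw [div_le_one (by positivity)]; exact hq1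
  calc e = ENNReal.ofReal (2 ^ (α + n + 1)) * (K * e * ENNReal.ofReal (1 / 2)) := by
        rw [hK, mul_right_comm, ← mul_assoc, ← ENNReal.ofReal_mul (by positivity),
          ← ENNReal.ofReal_mul (by positivity)]
        have : (2 : ℝ) ^ (α + n + 1) * (2 ^ (-(α + n)) * (1 / 2)) = 1 := by
          rw [← mul_assoc, ← Real.rpow_add two_pos, show α + n + 1 + -(α + n) = 1 by ring]
          norm_num
        rw [this]; simp
    _ ≤ _ := by
        gcongr
        exact (mul_le_mul_right hhalf _).trans hroot

end LocalApprox

/-! ### Polynomials on cubes -/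

section Polynomials

variable {n : ℕ}

/-- The monomial exponent attached to a tuple of bounded exponents. -/
def boundedExponent {m : ℕ} (e : Fin n → Fin m) : Fin n →₀ ℕ :=
  Finsupp.equivFunOnFinite.symm fun i => (e i : ℕ)

lemma boundedExponent_injective {m : ℕ} :
    Function.Injective (boundedExponent : (Fin n → Fin m) → Fin n →₀ ℕ) := by
  intro e e' h
  funext i
  exact Fin.ext (DFunLike.congr_fun h i)

/-- The polynomial with coefficients `c`, in which every variable has degree less than `m`. -/
def polyOfCoeffs {m : ℕ} (c : (Fin n → Fin m) → ℝ) : MvPolynomial (Fin n) ℝ :=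
  ∑ e, MvPolynomial.monomial (boundedExponent e) (c e)

lemma coeff_polyOfCoeffs {m : ℕ} (c : (Fin n → Fin m) → ℝ) (e : Fin n → Fin m) :
    (polyOfCoeffs c).coeff (boundedExponent e) = c e := by
  simp [polyOfCoeffs, MvPolynomial.coeff_sum, MvPolynomial.coeff_monomial,
    boundedExponent_injective.eq_iff]

lemma eval_polyOfCoeffs {m : ℕ} (c : (Fin n → Fin m) → ℝ) (u : Fin n → ℝ) :
    MvPolynomial.eval u (polyOfCoeffs c) = ∑ e, c e * ∏ i, u i ^ (e i : ℕ) := by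
  simp [polyOfCoeffs, MvPolynomial.eval_monomial, boundedExponent, Finsupp.prod_fintype]

lemma exists_polyOfCoeffs {m : ℕ} {P : MvPolynomial (Fin n) ℝ} (hP : P ∈ polysBelow n m) :
    ∃ c : (Fin n → Fin m) → ℝ, P = polyOfCoeffs c := by
  rcases hP with rfl | hP
  · exact ⟨0, by simp [polyOfCoeffs]⟩
  refine ⟨fun e => P.coeff (boundedExponent e), ?_⟩
  ext γ
  by_cases hγ : ∃ e : Fin n → Fin m, boundedExponent e = γ
  · obtain ⟨e, rfl⟩ := hγ
    rw [coeff_polyOfCoeffs]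
  · have h0 : (polyOfCoeffs fun e : Fin n → Fin m => P.coeff (boundedExponent e)).coeff γ = 0 := by
      rw [polyOfCoeffs, MvPolynomial.coeff_sum]
      refine Finset.sum_eq_zero fun e _ => ?_
      rw [MvPolynomial.coeff_monomial, if_neg fun h => hγ ⟨e, h⟩]
    rw [h0]
    by_contra hne
    have hlt : ∀ i, γ i < m := fun i => by
      have h1 := MvPolynomial.le_totalDegree (MvPolynomial.mem_support_iff.2 hne)
      have h2 : γ i ≤ γ.sum fun _ e => e := by
        rw [Finsupp.sum_fintype _ _ (by simp)]
        exact Finset.single_le_sum (fun _ _ => Nat.zero_le _) (Finset.mem_univ i)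
      omega
    exact hγ ⟨fun i => ⟨γ i, hlt i⟩, by ext i; rfl⟩

lemma continuous_eval (P : MvPolynomial (Fin n) ℝ) :
    Continuous fun u : E n => MvPolynomial.eval (fun i => u i) P :=
  (MvPolynomial.continuous_eval P).comp (by fun_prop)

lemma integrable_eval (P : MvPolynomial (Fin n) ℝ) :
    Integrable (fun u : E n => MvPolynomial.eval (fun i => u i) P) (cubeProb 0 1) :=
  integrable_cubeProb (continuous_eval P).locallyIntegrable 0 one_pos

lemma isOpen_setOf_abs_lt : IsOpen {u : E n | ∀ i, |u i| < 1} := by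
  simp only [Set.ofPred_forall]
  exact isOpen_iInter_of_finite fun i => isOpen_lt (by fun_prop) (by fun_prop)

lemma eq_zero_of_ae_eval_eq_zero {P : MvPolynomial (Fin n) ℝ}
    (h : (fun u : E n => MvPolynomial.eval (fun i => u i) P) =ᵐ[cubeProb 0 1] 0) : P = 0 := by
  have h1 : (fun u : E n => MvPolynomial.eval (fun i => u i) P)
      =ᵐ[volume.restrict {u : E n | ∀ i, |u i| < 1}] 0 := by
    have hsub : {u : E n | ∀ i, |u i| < 1} ⊆ cube 0 1 := fun u hu i => by
      simpa using (hu i).le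
    refine ae_restrict_of_ae_restrict_of_subset hsub ?_
    have hne : (volume (cube (0 : E n) 1))⁻¹ ≠ 0 := ENNReal.inv_ne_zero.2 (volume_cube_ne_top _ _)
    exact (Measure.ae_ennreal_smul_measure_iff hne).1 h
  have h2 := Measure.eqOn_open_of_ae_eq h1 isOpen_setOf_abs_lt (continuous_eval P).continuousOn
    continuousOn_const
  refine MvPolynomial.funext_set (s := fun _ => Ioo (-1 : ℝ) 1)
    (fun _ => Ioo_infinite (by norm_num)) fun x hx => ?_
  have := h2 (x := WithLp.toLp 2 x) fun i => abs_lt.2 (hx i (mem_univ i))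
  simpa using this

/-- All norms on the finite-dimensional space of polynomials are equivalent: the coefficients are
controlled by the mean of `|P|` over the unit cube. -/
lemma exists_abs_coeff_le (n m : ℕ) : ∃ C : ℝ≥0, ∀ (c : (Fin n → Fin m) → ℝ) (e : Fin n → Fin m),
    ENNReal.ofReal |c e| ≤
      C * ⨍⁻ u in cube (0 : E n) 1,
        ENNReal.ofReal |MvPolynomial.eval (fun i => u i) (polyOfCoeffs c)| ∂volume := by
  let Λ : ((Fin n → Fin m) → ℝ) →ₗ[ℝ] (E n →₁[cubeProb (0 : E n) 1] ℝ) :=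
    { toFun := fun c => (integrable_eval (polyOfCoeffs c)).toL1 _
      map_add' := fun c c' => by
        rw [← Integrable.toL1_add]
        congr 1
        funext u
        simp [eval_polyOfCoeffs, add_mul, Finset.sum_add_distrib]
      map_smul' := fun a c => by
        rw [RingHom.id_apply, ← Integrable.toL1_smul]
        congr 1
        funext u
        simp [eval_polyOfCoeffs, mul_assoc, Finset.mul_sum] }
  have hker : LinearMap.ker Λ = ⊥ := by
    rw [LinearMap.ker_eq_bot']
    intro c hc
    have h0 : polyOfCoeffs c = 0 :=
      eq_zero_of_ae_eval_eq_zero ((Integrable.toL1_eq_toL1_iff _ _ (integrable_eval _)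
        (integrable_zero _ _ _)).1
        (hc.trans (Integrable.toL1_zero _).symm))
    funext e
    rw [← coeff_polyOfCoeffs c e, h0]
    simp
  obtain ⟨K, -, hK⟩ := Λ.exists_antilipschitzWith hker
  refine ⟨K, fun c e => ?_⟩
  have h1 := hK c 0
  rw [map_zero, edist_zero_right, edist_zero_right] at h1
  have h2 : ‖Λ c‖ₑ = ⨍⁻ u in cube (0 : E n) 1,
      ENNReal.ofReal |MvPolynomial.eval (fun i => u i) (polyOfCoeffs c)| ∂volume := by
    rw [setLAverage_cube]
    refine (Integrable.enorm_toL1 (integrable_eval (polyOfCoeffs c))).trans ?_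
    simp only [Real.enorm_eq_ofReal_abs]
  rw [h2] at h1
  refine le_trans ?_ h1
  rw [← Real.norm_eq_abs, ← ofReal_norm c]
  exact ENNReal.ofReal_le_ofReal (norm_le_pi_norm c e)

lemma add_mem_polysBelow {k : ℕ} {P Q : MvPolynomial (Fin n) ℝ} (hP : P ∈ polysBelow n k)
    (hQ : Q ∈ polysBelow n k) : P + Q ∈ polysBelow n k := by
  rcases hP with rfl | hP
  · simpa using hQ
  rcases hQ with rfl | hQ
  · rw [add_zero]; exact Or.inr hP
  · exact Or.inr ((MvPolynomial.totalDegree_add _ _).trans_lt (max_lt hP hQ))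

lemma sub_mem_polysBelow {k : ℕ} {P Q : MvPolynomial (Fin n) ℝ} (hP : P ∈ polysBelow n k)
    (hQ : Q ∈ polysBelow n k) : P - Q ∈ polysBelow n k := by
  rw [sub_eq_add_neg]
  refine add_mem_polysBelow hP ?_
  rcases hQ with rfl | hQ
  · left; simp
  · right; simpa using hQ

/-- Truncating a polynomial at degree `k` produces an error of order `ρ ^ k` on the cube of
radius `ρ` about the origin. -/
lemma exists_truncation (n m : ℕ) {k : ℕ} (hk : 1 ≤ k) : ∃ C : ℝ≥0, ∀ P ∈ polysBelow n m,
    ∃ P' ∈ polysBelow n k, ∀ ρ : ℝ, 0 < ρ → ρ ≤ 1 → ∀ u ∈ cube (0 : E n) ρ,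
      ENNReal.ofReal |MvPolynomial.eval (fun i => u i) P - MvPolynomial.eval (fun i => u i) P'|
        ≤ C * ENNReal.ofReal (ρ ^ k) * ⨍⁻ v in cube (0 : E n) 1,
          ENNReal.ofReal |MvPolynomial.eval (fun i => v i) P| ∂volume := by
  obtain ⟨C, hC⟩ := exists_abs_coeff_le n m
  refine ⟨(Fintype.card (Fin n → Fin m)) * C, fun P hP => ?_⟩
  obtain ⟨c, rfl⟩ := exists_polyOfCoeffs hP
  refine ⟨polyOfCoeffs fun e => if ∑ i, (e i : ℕ) < k then c e else 0, ?_, ?_⟩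
  · right
    refine (MvPolynomial.totalDegree_finsetSum _ _).trans_lt ?_
    rw [Finset.sup_lt_iff (by exact hk)]
    intro e _
    beta_reduce
    split_ifs with he
    · refine (MvPolynomial.totalDegree_monomial_le _ _).trans_lt ?_
      rw [Finsupp.sum_fintype _ _ (by simp)]
      exact he
    · simpa using (show 0 < k from hk)
  · intro ρ hρ hρ1 u hu
    rw [eval_polyOfCoeffs, eval_polyOfCoeffs, ← Finset.sum_sub_distrib]
    have hterm : ∀ e : Fin n → Fin m,
        |c e * ∏ i, u i ^ (e i : ℕ)
          - (if ∑ i, (e i : ℕ) < k then c e else 0) * ∏ i, u i ^ (e i : ℕ)| ≤ |c e| * ρ ^ k := by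
      intro e
      split_ifs with he
      · simp only [sub_self, abs_zero]; positivity
      rw [zero_mul, sub_zero, abs_mul, Finset.abs_prod]
      refine mul_le_mul_of_nonneg_left ?_ (abs_nonneg _)
      calc ∏ i, |u i ^ (e i : ℕ)| ≤ ∏ i, ρ ^ (e i : ℕ) := by
            refine Finset.prod_le_prod (fun _ _ => abs_nonneg _) fun i _ => ?_
            rw [abs_pow]
            exact pow_le_pow_left₀ (abs_nonneg _) (by simpa using hu i) _
        _ = ρ ^ ∑ i, (e i : ℕ) := Finset.prod_pow_eq_pow_sum _ _ _
        _ ≤ ρ ^ k := pow_le_pow_of_le_one hρ.le hρ1 (not_lt.1 he)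
    calc _ ≤ ENNReal.ofReal (∑ e, |c e| * ρ ^ k) :=
          ENNReal.ofReal_le_ofReal
            ((Finset.abs_sum_le_sum_abs _ _).trans (Finset.sum_le_sum fun e _ => hterm e))
      _ = ∑ e, ENNReal.ofReal |c e| * ENNReal.ofReal (ρ ^ k) := by
          rw [ENNReal.ofReal_sum_of_nonneg fun _ _ => by positivity]
          exact Finset.sum_congr rfl fun e _ => ENNReal.ofReal_mul (abs_nonneg _)
      _ ≤ ∑ e : Fin n → Fin m, (C * ⨍⁻ v in cube (0 : E n) 1,
            ENNReal.ofReal |MvPolynomial.eval (fun i => v i) (polyOfCoeffs c)| ∂volume)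
              * ENNReal.ofReal (ρ ^ k) := by
          gcongr with e _; exact hC c e
      _ = _ := by
          rw [Finset.sum_const, Finset.card_univ, nsmul_eq_mul]
          push_cast
          ring

end Polynomials

/-! ### Lowering the order of approximation -/

section Marchaud

variable {n : ℕ}

/-- Approximation of the lower order `k` on a small cube: the difference of near-best polynomials of
orders `m` and `k` on the unit cube is replaced by its truncation at degree `k`. -/
lemma exists_localApprox_unitCube_le (n : ℕ) {m k : ℕ} (hk : 1 ≤ k) (hkm : k ≤ m) :
    ∃ C : ℝ≥0, ∀ F : E n → ℝ, AEMeasurable F (cubeProb 0 1) → ∀ ρ : ℝ, 0 < ρ → ρ ≤ 1 →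
      localApprox volume k F 0 ρ ≤
        (ENNReal.ofReal (1 / ρ) ^ n + C * ENNReal.ofReal (ρ ^ k)) * localApprox volume m F 0 1
          + C * ENNReal.ofReal (ρ ^ k) * localApprox volume k F 0 1 := by
  obtain ⟨C, hC⟩ := exists_truncation n m hk
  refine ⟨C, fun F hF ρ hρ hρ1 => ?_⟩
  have hCρ : (C : ℝ≥0∞) * ENNReal.ofReal (ρ ^ k) ≠ ∞ :=
    ENNReal.mul_ne_top ENNReal.coe_ne_top ENNReal.ofReal_ne_top
  have hρn : ENNReal.ofReal (1 / ρ) ^ n ≠ ∞ := ENNReal.pow_ne_top ENNReal.ofReal_ne_top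
  rw [← tsub_le_iff_left]
  refine le_mul_localApprox hCρ fun P₂ hP₂ => ?_
  rw [tsub_le_iff_left, ← tsub_le_iff_right]
  refine le_mul_localApprox (ENNReal.add_ne_top.2 ⟨hρn, hCρ⟩) fun P₁ hP₁ => ?_
  rw [tsub_le_iff_right]
  obtain ⟨P', hP', hPP'⟩ := hC (P₁ - P₂)
    (sub_mem_polysBelow hP₁ (polysBelow_mono hkm hP₂))
  set ev : MvPolynomial (Fin n) ℝ → E n → ℝ := fun P u => MvPolynomial.eval (fun i => u i) P
    with hev
  set δ : ℝ≥0∞ := C * ENNReal.ofReal (ρ ^ k) *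
    ⨍⁻ v in cube (0 : E n) 1, ENNReal.ofReal |ev (P₁ - P₂) v| ∂volume with hδ
  have hdiff : ⨍⁻ v in cube (0 : E n) 1, ENNReal.ofReal |ev (P₁ - P₂) v| ∂volume
      ≤ ⨍⁻ v in cube (0 : E n) 1, ENNReal.ofReal |F v - ev P₁ v| ∂volume
        + ⨍⁻ v in cube (0 : E n) 1, ENNReal.ofReal |F v - ev P₂ v| ∂volume := by
    simp only [setLAverage_cube]
    have hm : AEMeasurable (fun v => ENNReal.ofReal |F v - ev P₁ v|) (cubeProb 0 1) :=
      ((hF.sub (continuous_eval P₁).measurable.aemeasurable).abs).ennreal_ofReal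
    rw [← lintegral_add_left' hm]
    refine lintegral_mono fun v => ?_
    rw [← ENNReal.ofReal_add (abs_nonneg _) (abs_nonneg _)]
    refine ENNReal.ofReal_le_ofReal ?_
    have h1 : ev (P₁ - P₂) v = (F v - ev P₂ v) - (F v - ev P₁ v) := by
      simp only [hev, map_sub]; ring
    rw [h1, add_comm]
    exact abs_sub _ _
  have hmain : localApprox volume k F 0 ρ ≤
      ⨍⁻ v in cube (0 : E n) ρ, ENNReal.ofReal |F v - ev P₁ v| ∂volume + δ := by
    refine (localApprox_le (add_mem_polysBelow hP₂ hP')).trans ?_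
    have := isProbabilityMeasure_cubeProb (0 : E n) hρ
    have hδ' : δ = ∫⁻ _, δ ∂(cubeProb (0 : E n) ρ) := by simp
    conv_rhs => rw [hδ']
    simp only [setLAverage_cube]
    rw [← lintegral_add_right _ measurable_const]
    simp only [← setLAverage_cube]
    rw [setLAverage_cube_eq, setLAverage_cube_eq]
    refine mul_le_mul_right (setLIntegral_mono' (measurableSet_cube _ _) fun u hu => ?_) _
    refine le_trans ?_ (add_le_add_right (hPP' ρ hρ hρ1 u hu) _)
    rw [← ENNReal.ofReal_add (abs_nonneg _) (abs_nonneg _)]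
    refine ENNReal.ofReal_le_ofReal (le_of_eq_of_le ?_ (abs_add_le _ _))
    simp only [hev, map_sub, map_add]
    congr 1
    ring
  have hcube := setLAverage_cube_le (fun v => ENNReal.ofReal |F v - ev P₁ v|) hρ one_pos
    (cube_mono (0 : E n) hρ1)
  calc _ ≤ _ := hmain
    _ ≤ ENNReal.ofReal (1 / ρ) ^ n * ⨍⁻ v in cube (0 : E n) 1,
          ENNReal.ofReal |F v - ev P₁ v| ∂volume
        + C * ENNReal.ofReal (ρ ^ k) *
          (⨍⁻ v in cube (0 : E n) 1, ENNReal.ofReal |F v - ev P₁ v| ∂volume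
        + ⨍⁻ v in cube (0 : E n) 1, ENNReal.ofReal |F v - ev P₂ v| ∂volume) :=
        add_le_add hcube (mul_le_mul_right hdiff _)
    _ = _ := by ring

lemma exists_localApprox_le_dilate (n : ℕ) {m k : ℕ} (hk : 1 ≤ k) (hkm : k ≤ m) :
    ∃ C : ℝ≥0, ∀ f : E n → ℝ, AEMeasurable f volume → ∀ (x : E n) (R t : ℝ), 1 ≤ R → 0 < t →
      localApprox volume k f x t ≤
        (ENNReal.ofReal R ^ n + C * ENNReal.ofReal (R⁻¹ ^ k)) * localApprox volume m f x (R * t)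
          + C * ENNReal.ofReal (R⁻¹ ^ k) * localApprox volume k f x (R * t) := by
  obtain ⟨C, hC⟩ := exists_localApprox_unitCube_le n hk hkm
  refine ⟨C, fun f hf x R t hR ht => ?_⟩
  have hR0 : 0 < R := by linarith
  have hRt : 0 < R * t := by positivity
  have hmeas : AEMeasurable (fun u : E n => f (x + (R * t) • u)) (cubeProb 0 1) := by
    have h1 : AEMeasurable f ((cubeProb 0 1).map fun u => x + (R * t) • u) := by
      rw [map_affine_cubeProb x hRt one_pos]
      exact hf.mono_ac (cubeProb_absolutelyContinuous _ _)
    exact h1.comp_measurable (by fun_prop)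
  have h := hC _ hmeas R⁻¹ (by positivity) (inv_le_one_of_one_le₀ hR)
  rw [localApprox_affine k f x hRt (by positivity), localApprox_affine k f x hRt one_pos,
    localApprox_affine m f x hRt one_pos] at h
  rw [one_div, inv_inv, mul_one, show R * t * R⁻¹ = t by field_simp] at h
  exact h

/-- Marchaud-type inequality, in pointwise form: the smoothness function built from approximation
of order `m` controls approximation of every order `k > a` with `k ≤ m`, up to a local mean
of `|f|`. -/
lemma exists_localApprox_le_majorant (n : ℕ) {m k : ℕ} (hk : 1 ≤ k) (hkm : k ≤ m) {a α : ℝ}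
    (ha : 0 ≤ a) (haα : a ≤ α) (hak : a < k) :
    ∃ C : ℝ≥0, ∀ q : ℝ≥0∞, 1 ≤ q → ∀ f : E n → ℝ, AEMeasurable f volume →
      ∀ (x : E n) (t : ℝ), 0 < t → t ≤ 4 →
        ENNReal.ofReal (t ^ (-a)) * localApprox volume k f x t
          ≤ C * (smoothnessFn m α q f x + ∫⁻ y in cube x 4, ENNReal.ofReal |f y|) := by
  obtain ⟨C, hC⟩ := exists_localApprox_le_dilate n hk hkm
  -- As `a < k`, for large `R` the term with order `k` on the cube of radius `R t` is absorbed with the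
  -- factor `1 / 2` in the weighted quantity `t ^ (-a) E_k(f, Q(x, t))`.
  obtain ⟨R, hR2, hRC⟩ : ∃ R : ℝ, 2 ≤ R ∧ C * R ^ (a - k) ≤ 1 / 2 := by
    have h1 : Tendsto (fun R : ℝ => (C : ℝ) * R ^ (a - k)) atTop (𝓝 (C * 0)) := by
      have := (tendsto_rpow_neg_atTop (sub_pos.2 hak)).const_mul (C : ℝ)
      simpa using this
    rw [mul_zero] at h1
    exact ((eventually_ge_atTop 2).and (h1.eventually (ge_mem_nhds (by norm_num)))).exists
  have hR0 : 0 < R := by linarith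
  set D : ℝ≥0∞ := ENNReal.ofReal (R ^ a) * (ENNReal.ofReal R ^ n + C * ENNReal.ofReal (R⁻¹ ^ k))
    * ENNReal.ofReal (2 ^ (α + n + 1)) with hD
  have hDtop : D ≠ ∞ := by finiteness
  set B : ℝ≥0∞ := ENNReal.ofReal ((2 * R) ^ a) * (ENNReal.ofReal (2 * (1 / (2 * R))) ^ n)⁻¹ with hB
  have hBtop : B ≠ ∞ := by
    refine ENNReal.mul_ne_top ENNReal.ofReal_ne_top (ENNReal.inv_ne_top.2 (pow_ne_zero _ ?_))
    simp; positivity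
  refine ⟨(2 * D + B).toNNReal, fun q hq f hf x => ?_⟩
  rw [ENNReal.coe_toNNReal (by finiteness)]
  set g := smoothnessFn m α q f x
  set M := ∫⁻ y in cube x 4, ENNReal.ofReal |f y|
  have hbase : ∀ t : ℝ, 1 / (2 * R) < t → t ≤ 4 →
      ENNReal.ofReal (t ^ (-a)) * localApprox volume k f x t ≤ B * M := by
    intro t ht ht4
    have hR' : 0 < 1 / (2 * R) := by positivity
    have ht0 : 0 < t := hR'.trans ht
    rw [hB, mul_assoc]
    refine mul_le_mul' (ENNReal.ofReal_le_ofReal ?_) ?_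
    · rw [Real.rpow_neg ht0.le, ← Real.inv_rpow ht0.le]
      refine Real.rpow_le_rpow (by positivity) ?_ ha
      rw [inv_le_comm₀ ht0 (by positivity), inv_eq_one_div]
      exact ht.le
    · refine (localApprox_le_average volume k f x t).trans ?_
      rw [setLAverage_cube_eq, volume_cube]
      refine mul_le_mul' (ENNReal.inv_le_inv.2 ?_) (lintegral_mono_set (cube_mono x ht4))
      gcongr
  have hstep : ∀ t : ℝ, 0 < t → t ≤ 1 / (2 * R) →
      ENNReal.ofReal (t ^ (-a)) * localApprox volume k f x t ≤
        D * g + ENNReal.ofReal (1 / 2) *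
          (ENNReal.ofReal ((R * t) ^ (-a)) * localApprox volume k f x (R * t)) := by
    intro t ht ht'
    have hRt : R * t ≤ 1 / 2 := by
      calc R * t ≤ R * (1 / (2 * R)) := by gcongr
        _ = 1 / 2 := by field_simp
    have hRt0 : 0 < R * t := by positivity
    have hta : t ^ (-a) = R ^ a * (R * t) ^ (-a) := by
      rw [Real.mul_rpow hR0.le ht.le, ← mul_assoc, ← Real.rpow_add hR0]
      simp
    have hg := rpow_mul_localApprox_le_smoothnessFn m (ha.trans haα) hq f x hRt0 hRt
    have hpow : ENNReal.ofReal ((R * t) ^ (-a)) ≤ ENNReal.ofReal ((R * t) ^ (-α)) := by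
      refine ENNReal.ofReal_le_ofReal ?_
      exact Real.rpow_le_rpow_of_exponent_ge hRt0 (by linarith) (by linarith)
    have hhalf : ENNReal.ofReal (R ^ a) * (C * ENNReal.ofReal (R⁻¹ ^ k)) ≤ ENNReal.ofReal (1 / 2) := by
      rw [← ENNReal.ofReal_coe_nnreal, ← ENNReal.ofReal_mul (by positivity),
        ← ENNReal.ofReal_mul (by positivity)]
      refine ENNReal.ofReal_le_ofReal (le_of_eq_of_le ?_ hRC)
      rw [Real.rpow_sub hR0, Real.rpow_natCast, inv_pow]
      ring
    calc ENNReal.ofReal (t ^ (-a)) * localApprox volume k f x t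
        ≤ ENNReal.ofReal (R ^ a) * ENNReal.ofReal ((R * t) ^ (-a)) *
          ((ENNReal.ofReal R ^ n + C * ENNReal.ofReal (R⁻¹ ^ k)) * localApprox volume m f x (R * t)
          + C * ENNReal.ofReal (R⁻¹ ^ k) * localApprox volume k f x (R * t)) := by
          rw [hta, ENNReal.ofReal_mul (by positivity)]
          gcongr
          exact hC f hf x R t (by linarith) ht
      _ = ENNReal.ofReal (R ^ a) * (ENNReal.ofReal R ^ n + C * ENNReal.ofReal (R⁻¹ ^ k)) *
            (ENNReal.ofReal ((R * t) ^ (-a)) * localApprox volume m f x (R * t))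
          + ENNReal.ofReal (R ^ a) * (C * ENNReal.ofReal (R⁻¹ ^ k)) *
            (ENNReal.ofReal ((R * t) ^ (-a)) * localApprox volume k f x (R * t)) := by ring
      _ ≤ _ := by
          refine add_le_add ?_ (mul_le_mul_left hhalf _)
          rw [hD, mul_assoc _ _ g]
          exact mul_le_mul_right ((mul_le_mul_left hpow _).trans hg) _
  -- The bound passes from `R t` to `t`, since `D + (2 D) / 2 = 2 D`; large `t` are covered by `hbase`.
  have hind : ∀ (N : ℕ) (t : ℝ), 0 < t → t ≤ 4 → 1 / (2 * R) < R ^ N * t →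
      ENNReal.ofReal (t ^ (-a)) * localApprox volume k f x t ≤ 2 * D * g + B * M := by
    intro N
    induction N with
    | zero =>
      intro t _ ht4 hN
      exact (hbase t (by simpa using hN) ht4).trans le_add_self
    | succ N ih =>
      intro t ht ht4 hN
      by_cases htR : 1 / (2 * R) < t
      · exact (hbase t htR ht4).trans le_add_self
      have htR' := not_lt.1 htR
      have hRt : R * t ≤ 1 / 2 := by
        calc R * t ≤ R * (1 / (2 * R)) := by gcongr
          _ = 1 / 2 := by field_simp
      have h := ih (R * t) (by positivity) (by linarith) (by rw [pow_succ] at hN; linarith)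
      calc _ ≤ _ := hstep t ht htR'
        _ ≤ D * g + ENNReal.ofReal (1 / 2) * (2 * D * g + B * M) := by gcongr
        _ = D * g + (ENNReal.ofReal (1 / 2) * 2) * (D * g) + ENNReal.ofReal (1 / 2) * (B * M) := by
            ring
        _ ≤ D * g + 1 * (D * g) + 1 * (B * M) := by
            gcongr
            · rw [← ENNReal.ofReal_ofNat, ← ENNReal.ofReal_mul (by norm_num)]
              norm_num
            · rw [ENNReal.ofReal_le_one]; norm_num
        _ = _ := by ring
  intro t ht ht4
  obtain ⟨N, hN⟩ := pow_unbounded_of_one_lt (1 / (2 * R) / t) (by linarith : 1 < R)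
  refine (hind N t ht ht4 ((div_lt_iff₀ ht).1 hN)).trans ?_
  rw [mul_add]
  gcongr
  · exact le_self_add
  · exact le_add_self

end Marchaud

/-! ### Ahlfors regular measures and porosity -/

section Regular

variable {n : ℕ}

/-- The properties of `ℋᵈ|_S` for a `d`-set `S` on which the argument rests. The upper bound on
cubes with arbitrary centre is needed for radii at most `1 / 2` only. -/
structure IsRegular (d : ℝ) (S : Set (E n)) (μ : Measure (E n)) (c₁ c₂ : ℝ) : Prop where
  pos_left : 0 < c₁
  pos_right : 0 < c₂
  null_compl : μ Sᶜ = 0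
  le_measure : ∀ w ∈ S, ∀ r : ℝ, 0 < r → r ≤ 1 → ENNReal.ofReal (c₁ * r ^ d) ≤ μ (cube w r)
  measure_le : ∀ w ∈ S, ∀ r : ℝ, 0 < r → r ≤ 1 → μ (cube w r) ≤ ENNReal.ofReal (c₂ * r ^ d)
  measure_le' : ∀ z, ∀ r : ℝ, 0 < r → r ≤ 1 / 2 → μ (cube z r) ≤ ENNReal.ofReal (c₂ * r ^ d)

lemma exists_mem_of_measure_ne_zero {S : Set (E n)} {μ : Measure (E n)} (h : μ Sᶜ = 0)
    {A : Set (E n)} (hA : μ A ≠ 0) : ∃ w ∈ S, w ∈ A := by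
  by_contra! hne
  exact hA (measure_mono_null (fun w hw hwS => hne w hwS hw) h)

lemma IsDSet.exists_isRegular {d : ℝ} {S : Set (E n)} (hS : IsDSet d S) :
    ∃ c₁ c₂ : ℝ, IsRegular d S (measureOn d S) c₁ c₂ := by
  obtain ⟨hd, -, hcl, c₁, c₂, hc₁, hc₂, h⟩ := hS
  have hnull : measureOn d S Sᶜ = 0 := by
    rw [measureOn, Measure.restrict_apply hcl.measurableSet.compl]
    simp
  have heq : ∀ (w : E n) (r : ℝ), measureOn d S (cube w r) = (μH[d] : Measure (E n)) (cube w r ∩ S) :=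
    fun w r => Measure.restrict_apply (measurableSet_cube w r)
  have h2 : (1 : ℝ) ≤ 2 ^ d := Real.one_le_rpow one_le_two hd.le
  refine ⟨c₁, c₂ * 2 ^ d, hc₁, by positivity, hnull, ?_, ?_, ?_⟩
  · intro w hw r hr hr1
    rw [heq]; exact (h w hw r hr hr1).1
  · intro w hw r hr hr1
    rw [heq]
    refine (h w hw r hr hr1).2.trans (ENNReal.ofReal_le_ofReal ?_)
    gcongr
    nlinarith
  · intro z r hr hr1
    by_cases hz : measureOn d S (cube z r) = 0
    · rw [hz]; exact zero_le
    obtain ⟨w, hw, hwz⟩ := exists_mem_of_measure_ne_zero hnull hz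
    calc measureOn d S (cube z r) ≤ measureOn d S (cube w (2 * r)) :=
          measure_mono (cube_subset_cube (mem_cube_comm.1 hwz) (by linarith))
      _ ≤ ENNReal.ofReal (c₂ * (2 * r) ^ d) := by
          rw [heq]; exact (h w hw (2 * r) (by positivity) (by linarith)).2
      _ = _ := by rw [Real.mul_rpow two_pos.le hr.le, mul_assoc]

lemma IsDSet.sigmaFinite {d : ℝ} {S : Set (E n)} (hS : IsDSet d S) :
    SigmaFinite (measureOn d S) := by
  obtain ⟨-, -, hcl, c₁, c₂, -, -, h⟩ := hS
  have : IsLocallyFiniteMeasure (measureOn d S) := by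
    refine ⟨fun x => ?_⟩
    by_cases hx : x ∈ S
    · refine ⟨cube x 1, ?_, ?_⟩
      · refine mem_of_superset (Metric.ball_mem_nhds x one_pos) fun y hy i => ?_
        rw [← Real.norm_eq_abs]
        refine le_trans (PiLp.norm_apply_le (y - x) i) ?_
        rw [← dist_eq_norm]
        exact (Metric.mem_ball.1 hy).le
      · rw [measureOn, Measure.restrict_apply (measurableSet_cube x 1)]
        exact (h x hx 1 one_pos le_rfl).2.trans_lt ENNReal.ofReal_lt_top
    · refine ⟨Sᶜ, hcl.isOpen_compl.mem_nhds hx, ?_⟩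
      rw [measureOn, Measure.restrict_apply hcl.measurableSet.compl]
      simp
  infer_instance

variable {d : ℝ} {S : Set (E n)} {μ : Measure (E n)} {c₁ c₂ : ℝ}

/-- Upper bound for the volume of the part of a cube that lies close to `S`. By Tonelli's theorem
it reduces to counting volume around points of `S`, without any covering argument. -/
lemma IsRegular.volume_near_le [SFinite μ] (h : IsRegular d S μ c₁ c₂) {y : E n} (hy : y ∈ S)
    {r ε : ℝ} (hr : 0 < r) (hr' : r ≤ 1 / 2) (hε : 0 < ε) (hε' : ε ≤ 1 / 2) :
    volume (cube y r ∩ {z | μ (cube z (ε * r)) ≠ 0})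
      ≤ ENNReal.ofReal (c₂ / c₁ * 2 ^ (n + d) * ε ^ (n - d)) * volume (cube y r) := by
  set A := cube y r ∩ {z | μ (cube z (ε * r)) ≠ 0} with hA
  have hεr : 0 < ε * r := by positivity
  have hc₁ := h.pos_left
  have hc₂ := h.pos_right
  have hlow : ∀ z ∈ A, ENNReal.ofReal (c₁ * (ε * r) ^ d) ≤ μ (cube z (2 * (ε * r))) := by
    rintro z ⟨-, hz⟩
    obtain ⟨w, hw, hwz⟩ := exists_mem_of_measure_ne_zero h.null_compl hz
    refine (h.le_measure w hw _ hεr (by nlinarith)).trans (measure_mono ?_)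
    exact cube_subset_cube hwz (by linarith)
  have hAm : MeasurableSet A :=
    (measurableSet_cube y r).inter (measurable_measure_cube μ _ (measurableSet_singleton 0).compl)
  have hmain : ENNReal.ofReal (c₁ * (ε * r) ^ d) * volume A
      ≤ ENNReal.ofReal (2 * (2 * (ε * r))) ^ n * ENNReal.ofReal (c₂ * (2 * r) ^ d) := by
    calc ENNReal.ofReal (c₁ * (ε * r) ^ d) * volume A
        = ∫⁻ _ in A, ENNReal.ofReal (c₁ * (ε * r) ^ d) := by rw [setLIntegral_const]
      _ ≤ ∫⁻ z in A, μ (cube z (2 * (ε * r))) := setLIntegral_mono' hAm hlow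
      _ ≤ ∫⁻ z in cube y r, μ (cube z (2 * (ε * r))) := lintegral_mono_set inter_subset_left
      _ = ∫⁻ z in cube y r, ∫⁻ _ in cube z (2 * (ε * r)), 1 ∂μ := by simp
      _ = ∫⁻ w, 1 * (volume.restrict (cube y r)) (cube w (2 * (ε * r))) ∂μ :=
          lintegral_setLIntegral_cube measurable_const _
      _ ≤ ∫⁻ w, (cube y (2 * r)).indicator (fun _ => ENNReal.ofReal (2 * (2 * (ε * r))) ^ n) w ∂μ := by
          refine lintegral_mono fun w => ?_
          rw [one_mul]
          by_cases hw : w ∈ cube y (2 * r)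
          · rw [indicator_of_mem hw, ← volume_cube w]
            exact Measure.restrict_le_self _
          · rw [indicator_of_notMem hw, Measure.restrict_apply (measurableSet_cube _ _)]
            refine le_of_eq (measure_mono_null (fun v hv => hw ?_) measure_empty)
            exact mem_cube_trans hv.2 (mem_cube_comm.1 hv.1) (by nlinarith)
      _ = ENNReal.ofReal (2 * (2 * (ε * r))) ^ n * μ (cube y (2 * r)) :=
          lintegral_indicator_const (measurableSet_cube _ _) _
      _ ≤ _ := by
          gcongr
          exact h.measure_le y hy _ (by positivity) (by linarith)
  have hK0 : ENNReal.ofReal (c₁ * (ε * r) ^ d) ≠ 0 := by simp; positivity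
  have h2 := (ENNReal.le_div_iff_mul_le (Or.inl hK0) (Or.inl ENNReal.ofReal_ne_top)).2
    ((mul_comm _ _).trans_le hmain)
  refine h2.trans (le_of_eq ?_)
  rw [volume_cube, ← ENNReal.ofReal_pow (by positivity), ← ENNReal.ofReal_pow (by positivity),
    ← ENNReal.ofReal_mul (by positivity), ← ENNReal.ofReal_mul (by positivity),
    ← ENNReal.ofReal_div_of_pos (by positivity)]
  congr 1
  rw [Real.mul_rpow hε.le hr.le, Real.mul_rpow two_pos.le hr.le, Real.rpow_sub hε,
    Real.rpow_add two_pos, Real.rpow_natCast, Real.rpow_natCast]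
  simp only [mul_pow]
  field_simp

/-- Since `d < n`, the set `S` is porous: at a suitable fixed relative scale `2 ^ (-s)`, at least
half of every cube centred on `S` stays away from `S`. -/
lemma IsRegular.exists_porosity [SFinite μ] (h : IsRegular d S μ c₁ c₂) (hdn : d < n) :
    ∃ s : ℕ, ∀ y ∈ S, ∀ r : ℝ, 0 < r → r ≤ 1 / 2 →
      volume (cube y r) ≤ 2 * volume (cube y r ∩ {z | μ (cube z ((1 / 2) ^ s * r)) = 0}) := by
  obtain ⟨s, hs1, hs⟩ : ∃ s : ℕ, 1 ≤ s ∧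
      c₂ / c₁ * 2 ^ (n + d) * ((1 / 2 : ℝ) ^ s) ^ (n - d) ≤ 1 / 2 := by
    have h1 : Tendsto (fun s : ℕ => ((1 / 2 : ℝ) ^ s) ^ (n - d)) atTop (𝓝 (0 ^ (n - d))) :=
      (tendsto_pow_atTop_nhds_zero_of_lt_one (by norm_num) (by norm_num)).rpow_const
        (Or.inr (by linarith))
    rw [Real.zero_rpow (by linarith)] at h1
    have h2 := h1.const_mul (c₂ / c₁ * 2 ^ (n + d))
    rw [mul_zero] at h2
    exact ((eventually_ge_atTop 1).and (h2.eventually (ge_mem_nhds (by norm_num)))).exists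
  refine ⟨s, fun y hy r hr hr' => ?_⟩
  have hε : (1 / 2 : ℝ) ^ s ≤ 1 / 2 := pow_le_of_le_one (by norm_num) (by norm_num) (by omega)
  have hnear := h.volume_near_le hy hr hr' (by positivity) hε
  have hnear' : volume (cube y r ∩ {z | μ (cube z ((1 / 2) ^ s * r)) ≠ 0})
      ≤ 2⁻¹ * volume (cube y r) := by
    refine hnear.trans (mul_le_mul_left ((ENNReal.ofReal_le_ofReal hs).trans_eq ?_) _)
    rw [one_div, ENNReal.ofReal_inv_of_pos two_pos]; simp
  have hsplit : volume (cube y r) ≤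
      volume (cube y r ∩ {z | μ (cube z ((1 / 2) ^ s * r)) = 0})
        + volume (cube y r ∩ {z | μ (cube z ((1 / 2) ^ s * r)) ≠ 0}) := by
    refine (measure_mono fun z hz => ?_).trans (measure_union_le _ _)
    by_cases h0 : μ (cube z ((1 / 2) ^ s * r)) = 0
    · exact Or.inl ⟨hz, h0⟩
    · exact Or.inr ⟨hz, h0⟩
  have htop := volume_cube_ne_top y r
  have h3 : volume (cube y r) ≤ volume (cube y r ∩ {z | μ (cube z ((1 / 2) ^ s * r)) = 0})
      + 2⁻¹ * volume (cube y r) := hsplit.trans (add_le_add_right hnear' _)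
  have h4 : volume (cube y r) = 2⁻¹ * volume (cube y r) + 2⁻¹ * volume (cube y r) := by
    rw [← add_mul, ENNReal.inv_two_add_inv_two, one_mul]
  have h5 : 2⁻¹ * volume (cube y r)
      ≤ volume (cube y r ∩ {z | μ (cube z ((1 / 2) ^ s * r)) = 0}) := by
    rw [h4] at h3
    refine (ENNReal.add_le_add_iff_right (by finiteness)).1 (h3.trans_eq ?_)
    rw [← h4]
  calc volume (cube y r) = 2 * (2⁻¹ * volume (cube y r)) := by
        rw [← mul_assoc, ENNReal.mul_inv_cancel two_ne_zero ENNReal.ofNat_ne_top, one_mul]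
    _ ≤ _ := mul_le_mul_right h5 _

/-- A decreasing predicate changes from true to false within a window of length `s` starting at
`j` for at most `s` values of `j`. -/
lemma tsum_indicator_window_le {A : ℕ → Prop} (hA : ∀ i j, i ≤ j → A j → A i) (s : ℕ) :
    ∑' j, {j | A j ∧ ¬ A (j + s)}.indicator (fun _ => (1 : ℝ≥0∞)) j ≤ s := by
  classical
  by_cases hex : ∃ j, ¬ A j
  · have hsub : ∀ j, j ∉ Finset.Ico (Nat.find hex - s) (Nat.find hex) →
        {j | A j ∧ ¬ A (j + s)}.indicator (fun _ => (1 : ℝ≥0∞)) j = 0 := by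
      intro j hj
      refine indicator_of_notMem (fun hmem => hj ?_) _
      have h1 : Nat.find hex ≤ j + s := Nat.find_min' hex hmem.2
      have h2 : j < Nat.find hex := by
        by_contra! hle
        exact Nat.find_spec hex (hA _ _ hle hmem.1)
      exact Finset.mem_Ico.2 ⟨by omega, h2⟩
    rw [tsum_eq_sum hsub]
    calc _ ≤ ∑ j ∈ Finset.Ico (Nat.find hex - s) (Nat.find hex), (1 : ℝ≥0∞) :=
          Finset.sum_le_sum fun j _ => indicator_le_self' (fun _ _ => zero_le_one) j
      _ = ((Nat.find hex - (Nat.find hex - s) : ℕ) : ℝ≥0∞) := by simp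
      _ ≤ s := by exact_mod_cast (by omega)
  · push Not at hex
    have : {j | A j ∧ ¬ A (j + s)} = ∅ := eq_empty_of_forall_notMem fun j hj => hj.2 (hex _)
    simp [this]

end Regular

/-! ### Hölder's inequality for means, and a Hardy inequality -/

section Holder

/-- Jensen's inequality for the power `p`, for a measure that need not be normalised. -/
lemma rpow_lintegral_le {X : Type*} [MeasurableSpace X] (ν : Measure X) {f : X → ℝ≥0∞}
    (hf : AEMeasurable f ν) {p : ℝ} (hp : 1 < p) :
    (∫⁻ x, f x ∂ν) ^ p ≤ ν univ ^ (p - 1) * ∫⁻ x, f x ^ p ∂ν := by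
  have hp0 : 0 < p := by linarith
  have hpq : p.HolderConjugate (p / (p - 1)) := Real.HolderConjugate.conjExponent hp
  have h := ENNReal.lintegral_mul_le_Lp_mul_Lq ν hpq hf (aemeasurable_const (b := (1 : ℝ≥0∞)))
  simp only [Pi.mul_apply, mul_one, ENNReal.one_rpow, lintegral_const, one_mul] at h
  have h2 := ENNReal.rpow_le_rpow h hp0.le
  rw [ENNReal.mul_rpow_of_nonneg _ _ hp0.le, ← ENNReal.rpow_mul, ← ENNReal.rpow_mul,
    one_div_mul_cancel hp0.ne', ENNReal.rpow_one] at h2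
  rw [mul_comm]
  refine h2.trans_eq ?_
  congr 2
  have : p - 1 ≠ 0 := by linarith
  field_simp

lemma rpow_setLAverage_le {X : Type*} [MeasurableSpace X] (ν : Measure X) (A : Set X)
    {f : X → ℝ≥0∞} (hf : Measurable f) {p : ℝ} (hp : 1 < p) :
    (⨍⁻ x in A, f x ∂ν) ^ p ≤ ⨍⁻ x in A, f x ^ p ∂ν := by
  refine (rpow_lintegral_le _ hf.aemeasurable hp).trans ?_
  refine (mul_le_mul_left (ENNReal.rpow_le_one ?_ (by linarith)) _).trans_eq (one_mul _)
  rw [Measure.smul_apply, smul_eq_mul]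
  exact ENNReal.inv_mul_le_one _

lemma rpow_tsum_mul_le (ω x : ℕ → ℝ≥0∞) {p : ℝ} (hp : 1 < p) :
    (∑' l, ω l * x l) ^ p ≤ (∑' l, ω l) ^ (p - 1) * ∑' l, ω l * x l ^ p := by
  have h := rpow_lintegral_le (Measure.sum fun l : ℕ => ω l • Measure.dirac l)
    (f := x) (measurable_of_countable x).aemeasurable hp
  simpa [lintegral_sum_measure, lintegral_smul_measure] using h

lemma tsum_two_rpow_neg_ne_top {γ : ℝ} (hγ : 0 < γ) :
    ∑' l : ℕ, ENNReal.ofReal (2 ^ (-(l * γ))) ≠ ∞ := by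
  have h : ∀ l : ℕ, (2 : ℝ) ^ (-(l * γ)) = (2 ^ (-γ)) ^ l := fun l => by
    rw [← Real.rpow_natCast, ← Real.rpow_mul two_pos.le]; ring_nf
  simp only [h]
  rw [← ENNReal.ofReal_tsum_of_nonneg (fun l => by positivity)]
  · exact ENNReal.ofReal_ne_top
  · exact summable_geometric_of_lt_one (by positivity)
      (Real.rpow_lt_one_of_one_lt_of_neg one_lt_two (by linarith))

/-- Discrete Hardy inequality for tails of series, with geometric weights. -/
lemma exists_hardy {p γ : ℝ} (hp : 1 < p) (hγ : 0 < γ) : ∃ K : ℝ≥0, ∀ b : ℕ → ℝ≥0∞,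
    ∑' i : ℕ, ENNReal.ofReal (2 ^ (i * γ)) * (∑' l, b (i + l) ^ (1 / p)) ^ p
      ≤ K * ∑' j : ℕ, ENNReal.ofReal (2 ^ (j * γ)) * b j := by
  have hp0 : 0 < p := by linarith
  -- Weights `2 ^ (-l δ)` with `δ p < γ` make all geometric series below converge.
  set δ := γ / (2 * p) with hδ
  have hδ0 : 0 < δ := by positivity
  set W : ℝ≥0∞ := ∑' l : ℕ, ENNReal.ofReal (2 ^ (-(l * δ))) with hW
  set V : ℝ≥0∞ := ∑' l : ℕ, ENNReal.ofReal (2 ^ (-(l * (γ / 2)))) with hV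
  have hWtop : W ≠ ∞ := tsum_two_rpow_neg_ne_top hδ0
  have hVtop : V ≠ ∞ := tsum_two_rpow_neg_ne_top (by positivity)
  have hKtop : W ^ (p - 1) * V ≠ ∞ :=
    ENNReal.mul_ne_top (ENNReal.rpow_ne_top_of_nonneg (by linarith) hWtop) hVtop
  refine ⟨(W ^ (p - 1) * V).toNNReal, fun b => ?_⟩
  rw [ENNReal.coe_toNNReal hKtop]
  have hterm : ∀ i, (∑' l, b (i + l) ^ (1 / p)) ^ p
      ≤ W ^ (p - 1) * ∑' l : ℕ, ENNReal.ofReal (2 ^ (l * (δ * (p - 1)))) * b (i + l) := by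
    intro i
    have h := rpow_tsum_mul_le (fun l : ℕ => ENNReal.ofReal (2 ^ (-(l * δ))))
      (fun l => ENNReal.ofReal (2 ^ (l * δ)) * b (i + l) ^ (1 / p)) hp
    have h1 : ∀ l : ℕ, ENNReal.ofReal (2 ^ (-(l * δ))) *
        (ENNReal.ofReal (2 ^ (l * δ)) * b (i + l) ^ (1 / p)) = b (i + l) ^ (1 / p) := fun l => by
      rw [← mul_assoc, ← ENNReal.ofReal_mul (by positivity), ← Real.rpow_add two_pos]
      simp
    have h2 : ∀ l : ℕ, ENNReal.ofReal (2 ^ (-(l * δ))) *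
        (ENNReal.ofReal (2 ^ (l * δ)) * b (i + l) ^ (1 / p)) ^ p
          = ENNReal.ofReal (2 ^ (l * (δ * (p - 1)))) * b (i + l) := fun l => by
      rw [ENNReal.mul_rpow_of_nonneg _ _ hp0.le, ← ENNReal.rpow_mul, one_div_mul_cancel hp0.ne',
        ENNReal.rpow_one, ENNReal.ofReal_rpow_of_pos (by positivity), ← mul_assoc,
        ← ENNReal.ofReal_mul (by positivity), ← Real.rpow_mul two_pos.le,
        ← Real.rpow_add two_pos]
      ring_nf
    simp only [h1, h2] at h
    exact h
  calc _ ≤ ∑' i : ℕ, ENNReal.ofReal (2 ^ (i * γ)) *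
        (W ^ (p - 1) * ∑' l : ℕ, ENNReal.ofReal (2 ^ (l * (δ * (p - 1)))) * b (i + l)) :=
        ENNReal.tsum_le_tsum fun i => mul_le_mul_right (hterm i) _
    _ = W ^ (p - 1) * ∑' l : ℕ, ∑' i : ℕ, ENNReal.ofReal (2 ^ (i * γ)) *
          (ENNReal.ofReal (2 ^ (l * (δ * (p - 1)))) * b (i + l)) := by
        rw [ENNReal.tsum_comm, ← ENNReal.tsum_mul_left]
        refine tsum_congr fun i => ?_
        rw [ENNReal.tsum_mul_left]
        ring
    _ ≤ W ^ (p - 1) * ∑' l : ℕ, ENNReal.ofReal (2 ^ (-(l * (γ / 2)))) *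
          ∑' j : ℕ, ENNReal.ofReal (2 ^ (j * γ)) * b j := by
        gcongr with l
        calc _ ≤ ∑' i : ℕ, ENNReal.ofReal (2 ^ (-(l * (γ / 2)))) *
              (ENNReal.ofReal (2 ^ ((i + l : ℕ) * γ)) * b (i + l)) := by
              refine ENNReal.tsum_le_tsum fun i => ?_
              rw [← mul_assoc (ENNReal.ofReal _), ← mul_assoc (ENNReal.ofReal _),
                ← ENNReal.ofReal_mul (by positivity), ← ENNReal.ofReal_mul (by positivity),
                ← Real.rpow_add two_pos, ← Real.rpow_add two_pos]
              refine mul_le_mul_left (ENNReal.ofReal_le_ofReal ?_) _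
              refine Real.rpow_le_rpow_of_exponent_le one_le_two ?_
              have h1 : δ * (p - 1) ≤ γ / 2 := by
                rw [hδ, div_mul_eq_mul_div, div_le_div_iff₀ (by positivity) two_pos]
                nlinarith
              have h2 : (l : ℝ) * (δ * (p - 1)) ≤ l * (γ / 2) :=
                mul_le_mul_of_nonneg_left h1 (Nat.cast_nonneg l)
              push_cast
              nlinarith
          _ ≤ _ := by
              rw [ENNReal.tsum_mul_left]
              refine mul_le_mul_right ?_ _
              exact ENNReal.tsum_comp_le_tsum_of_injective (add_left_injective l)
                (fun j : ℕ => ENNReal.ofReal (2 ^ (j * γ)) * b j)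
    _ = _ := by rw [ENNReal.tsum_mul_right, mul_assoc]

end Holder

/-! ### Passing from `ℝⁿ` to `S` -/

section KeyEstimate

variable {n : ℕ} {d : ℝ} {S : Set (E n)} {μ : Measure (E n)} {c₁ c₂ : ℝ}

/-- Averaging over cubes of a fixed radius is bounded on `L^p(S)`. -/
lemma IsRegular.lintegral_setLAverage_rpow_le [SFinite μ] (h : IsRegular d S μ c₁ c₂)
    {U : E n → ℝ≥0∞} (hU : Measurable U) {p : ℝ} (hp : 1 < p) {r : ℝ} (hr : 0 < r) (hr' : r ≤ 1) :
    ∫⁻ x, (⨍⁻ y in cube x r, U y ∂μ) ^ p ∂μ ≤ ENNReal.ofReal (c₂ / c₁) * ∫⁻ y, U y ^ p ∂μ := by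
  have hS : ∀ᵐ x ∂μ, x ∈ S := h.null_compl
  have hc₁ := h.pos_left
  have hc₂ := h.pos_right
  calc ∫⁻ x, (⨍⁻ y in cube x r, U y ∂μ) ^ p ∂μ
      ≤ ∫⁻ x, (ENNReal.ofReal (c₁ * r ^ d))⁻¹ * ∫⁻ y in cube x r, U y ^ p ∂μ ∂μ := by
        refine lintegral_mono_ae ?_
        filter_upwards [hS] with x hx
        refine (rpow_setLAverage_le μ _ hU hp).trans ?_
        rw [setLAverage_eq, ENNReal.div_eq_inv_mul]
        exact mul_le_mul_left (ENNReal.inv_le_inv.2 (h.le_measure x hx r hr hr')) _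
    _ = (ENNReal.ofReal (c₁ * r ^ d))⁻¹ * ∫⁻ y, U y ^ p * μ (cube y r) ∂μ := by
        rw [lintegral_const_mul _ (measurable_setLIntegral_cube (hU.pow_const p) r),
          lintegral_setLIntegral_cube (hU.pow_const p)]
    _ ≤ (ENNReal.ofReal (c₁ * r ^ d))⁻¹ * ∫⁻ y, ENNReal.ofReal (c₂ * r ^ d) * U y ^ p ∂μ := by
        refine mul_le_mul_right (lintegral_mono_ae ?_) _
        filter_upwards [hS] with y hy
        rw [mul_comm]
        exact mul_le_mul_left (h.measure_le y hy r hr hr') _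
    _ = _ := by
        rw [lintegral_const_mul _ (hU.pow_const p), ← mul_assoc,
          ← ENNReal.ofReal_inv_of_pos (by positivity), ← ENNReal.ofReal_mul (by positivity)]
        congr 2
        field_simp

/-- The integral of `2 ^ (- j a p) H ^ p` over the part of the cube `Q(y, 2 ^ (- j - 1))` that stays
away from the support of `μ`, divided by the volume of the whole cube. If `y` is in the support, that
part lies at distance about `2 ^ (-j)` from it. The distance condition is expressed through
`μ` itself, which makes measurability evident: `z` is kept if `μ` vanishes on the cube about `z`
which is smaller by the factor `2 ^ (-s)`. -/
def awayMean (μ : Measure (E n)) (s : ℕ) (a p : ℝ) (H : E n → ℝ≥0∞) (j : ℕ) (y : E n) : ℝ≥0∞ :=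
  ENNReal.ofReal (2 ^ (-(j * (a * p)))) *
    ((volume (cube y ((1 / 2) ^ (j + 1))))⁻¹ * ∫⁻ z in cube y ((1 / 2) ^ (j + 1)),
      {z | μ (cube z ((1 / 2) ^ s * (1 / 2) ^ (j + 1))) = 0}.indicator (fun z => H z ^ p) z)

lemma measurableSet_away (μ : Measure (E n)) [SFinite μ] (r : ℝ) :
    MeasurableSet {z : E n | μ (cube z r) = 0} :=
  measurable_measure_cube μ r (measurableSet_singleton 0)

lemma measurable_awayMean (μ : Measure (E n)) [SFinite μ] (s : ℕ) (a p : ℝ) {H : E n → ℝ≥0∞}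
    (hH : Measurable H) (j : ℕ) : Measurable (awayMean μ s a p H j) := by
  unfold awayMean
  simp only [volume_cube]
  exact ((measurable_setLIntegral_cube
    ((hH.pow_const p).indicator (measurableSet_away μ _)) _).const_mul _).const_mul _

/-- A quantity that is bounded by `2 ^ (- j a) H` on all of `Q(y, 2 ^ (- j - 1))` is bounded by the
mean over the part of the cube that stays away from `S`. -/
lemma rpow_le_awayMean [SFinite μ] {s : ℕ}
    (hs : ∀ y ∈ S, ∀ r : ℝ, 0 < r → r ≤ 1 / 2 →
      volume (cube y r) ≤ 2 * volume (cube y r ∩ {z | μ (cube z ((1 / 2) ^ s * r)) = 0}))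
    {a p : ℝ} (hp : 0 < p) {H : E n → ℝ≥0∞} (hH : Measurable H) {j : ℕ} {y : E n} (hy : y ∈ S)
    {v C : ℝ≥0∞}
    (hv : ∀ᵐ z, z ∈ cube y ((1 / 2) ^ (j + 1)) → v ≤ C * (ENNReal.ofReal (2 ^ (-(j * a))) * H z)) :
    v ^ p ≤ 2 * C ^ p * awayMean μ s a p H j y := by
  have hr : (0 : ℝ) < (1 / 2) ^ (j + 1) := by positivity
  have hr' : (1 / 2 : ℝ) ^ (j + 1) ≤ 1 / 2 := pow_le_of_le_one (by norm_num) (by norm_num) (by omega)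
  have hvol := hs y hy _ hr hr'
  set r : ℝ := (1 / 2) ^ (j + 1)
  set G : Set (E n) := {z | μ (cube z ((1 / 2) ^ s * r)) = 0} with hG
  have hGm : MeasurableSet G := measurableSet_away μ _
  have hint : volume (cube y r ∩ G) * v ^ p ≤
      C ^ p * ENNReal.ofReal (2 ^ (-(j * (a * p)))) *
        ∫⁻ z in cube y r, G.indicator (fun z => H z ^ p) z := by
    calc volume (cube y r ∩ G) * v ^ p = ∫⁻ _ in cube y r ∩ G, v ^ p := by
          rw [setLIntegral_const, mul_comm]
      _ ≤ ∫⁻ z in cube y r ∩ G, C ^ p * ENNReal.ofReal (2 ^ (-(j * (a * p)))) * H z ^ p := by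
          refine setLIntegral_mono_ae' ((measurableSet_cube y r).inter hGm) ?_
          filter_upwards [hv] with z hz hzA
          refine (ENNReal.rpow_le_rpow (hz hzA.1) hp.le).trans_eq ?_
          rw [ENNReal.mul_rpow_of_nonneg _ _ hp.le, ENNReal.mul_rpow_of_nonneg _ _ hp.le,
            ENNReal.ofReal_rpow_of_pos (by positivity), ← Real.rpow_mul two_pos.le, mul_assoc]
          congr 4
          ring
      _ = _ := by
          rw [lintegral_const_mul _ (hH.pow_const p), lintegral_indicator hGm,
            Measure.restrict_restrict hGm, inter_comm]
  have hv0 := volume_cube_ne_zero y hr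
  have hvt := volume_cube_ne_top y r
  calc v ^ p = (volume (cube y r))⁻¹ * (volume (cube y r) * v ^ p) := by
        rw [← mul_assoc, ENNReal.inv_mul_cancel hv0 hvt, one_mul]
    _ ≤ (volume (cube y r))⁻¹ * (2 * volume (cube y r ∩ G) * v ^ p) := by gcongr
    _ = 2 * (volume (cube y r))⁻¹ * (volume (cube y r ∩ G) * v ^ p) := by ring
    _ ≤ 2 * (volume (cube y r))⁻¹ * (C ^ p * ENNReal.ofReal (2 ^ (-(j * (a * p)))) *
        ∫⁻ z in cube y r, G.indicator (fun z => H z ^ p) z) := by gcongr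
    _ = _ := by rw [awayMean]; ring

/-- The means over the parts of cubes away from `S`, summed over all scales and integrated over
`S`, are controlled by a single integral over `ℝⁿ`: these parts overlap boundedly. -/
lemma IsRegular.tsum_lintegral_awayMean_le [SFinite μ] (h : IsRegular d S μ c₁ c₂) (hd : 0 < d)
    (s : ℕ) (a p : ℝ) {H : E n → ℝ≥0∞} (hH : Measurable H) :
    ∑' j : ℕ, ENNReal.ofReal (2 ^ (j * (a * p - (n - d)))) * ∫⁻ y, awayMean μ s a p H j y ∂μ
      ≤ ENNReal.ofReal c₂ * s * ∫⁻ z, H z ^ p := by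
  have hc₂ := h.pos_right
  let A : E n → ℕ → Prop := fun z j => μ (cube z ((1 / 2) ^ (j + 1))) ≠ 0
  let W : ℕ → Set (E n) := fun j => {z | A z j ∧ ¬ A z (j + s)}
  have hWm : ∀ j, MeasurableSet (W j) := fun j =>
    (measurableSet_away μ _).compl.inter (measurableSet_away μ _).compl.compl
  have hHp : Measurable fun z => H z ^ p := hH.pow_const p
  have hWH : ∀ j, Measurable fun z => (W j).indicator (fun _ => (1 : ℝ≥0∞)) z * H z ^ p :=
    fun j => (measurable_const.indicator (hWm j)).mul hHp
  have hterm : ∀ j : ℕ, ENNReal.ofReal (2 ^ (j * (a * p - (n - d)))) *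
      ∫⁻ y, awayMean μ s a p H j y ∂μ
        ≤ ENNReal.ofReal c₂ * ∫⁻ z, (W j).indicator (fun _ => 1) z * H z ^ p := by
    intro j
    set r : ℝ := (1 / 2) ^ (j + 1) with hr
    have hr0 : 0 < r := by positivity
    have hr' : r ≤ 1 / 2 := pow_le_of_le_one (by norm_num) (by norm_num) (by omega)
    set G : Set (E n) := {z | μ (cube z ((1 / 2) ^ s * r)) = 0} with hG
    have hGm : MeasurableSet G := measurableSet_away μ _
    have hGH : Measurable (G.indicator fun z => H z ^ p) := hHp.indicator hGm
    have h1 : ∫⁻ y, awayMean μ s a p H j y ∂μ =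
        ENNReal.ofReal (2 ^ (-(j * (a * p)))) * ((ENNReal.ofReal (2 * r) ^ n)⁻¹ *
          ∫⁻ z, G.indicator (fun z => H z ^ p) z * μ (cube z r)) := by
      simp only [awayMean, volume_cube]
      rw [lintegral_const_mul _ ((measurable_setLIntegral_cube hGH r).const_mul _),
        lintegral_const_mul _ (measurable_setLIntegral_cube hGH r),
        lintegral_setLIntegral_cube hGH]
    have h2 : ∀ z, G.indicator (fun z => H z ^ p) z * μ (cube z r)
        ≤ ENNReal.ofReal (c₂ * r ^ d) * ((W j).indicator (fun _ => 1) z * H z ^ p) := by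
      intro z
      by_cases hz : z ∈ G
      · by_cases hz' : μ (cube z r) = 0
        · rw [hz', mul_zero]; exact zero_le
        · have hzW : z ∈ W j := by
            refine ⟨hz', not_not.2 ?_⟩
            rw [← show μ (cube z ((1 / 2) ^ s * r)) = 0 from hz, hr, ← pow_add]
            congr 3; omega
          rw [indicator_of_mem hz, indicator_of_mem hzW, one_mul, mul_comm]
          exact mul_le_mul_left (h.measure_le' z r hr0 hr') _
      · rw [indicator_of_notMem hz, zero_mul]; exact zero_le
    have hrj : 2 * r = 2 ^ (-(j : ℝ)) := by
      rw [hr, Real.rpow_neg two_pos.le, Real.rpow_natCast, one_div, inv_pow, pow_succ]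
      field_simp
    have hrd : r ^ d ≤ 2 ^ (-(j : ℝ) * d) := by
      rw [Real.rpow_mul two_pos.le, ← hrj]
      exact Real.rpow_le_rpow hr0.le (by linarith) hd.le
    rw [h1]
    calc _ ≤ ENNReal.ofReal (2 ^ (j * (a * p - (n - d)))) *
          (ENNReal.ofReal (2 ^ (-(j * (a * p)))) * ((ENNReal.ofReal (2 * r) ^ n)⁻¹ *
          ∫⁻ z, ENNReal.ofReal (c₂ * r ^ d) * ((W j).indicator (fun _ => 1) z * H z ^ p))) := by
          exact mul_le_mul_right (mul_le_mul_right (mul_le_mul_right (lintegral_mono h2) _) _) _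
      _ = ENNReal.ofReal (2 ^ (j * (a * p - (n - d))) * 2 ^ (-(j * (a * p))) * ((2 * r) ^ n)⁻¹ *
          (c₂ * r ^ d)) * ∫⁻ z, (W j).indicator (fun _ => 1) z * H z ^ p := by
          rw [lintegral_const_mul _ (hWH j),
            ← ENNReal.ofReal_pow (by positivity), ← ENNReal.ofReal_inv_of_pos (by positivity),
            ← mul_assoc, ← mul_assoc, ← mul_assoc, ← ENNReal.ofReal_mul (by positivity),
            ← ENNReal.ofReal_mul (by positivity), ← ENNReal.ofReal_mul (by positivity)]
      _ ≤ _ := by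
          refine mul_le_mul_left (ENNReal.ofReal_le_ofReal ?_) _
          calc _ ≤ (2 : ℝ) ^ (j * (a * p - (n - d))) * 2 ^ (-(j * (a * p))) * ((2 * r) ^ n)⁻¹ *
                (c₂ * 2 ^ (-(j : ℝ) * d)) := by gcongr
            _ = c₂ * (2 ^ (j * (a * p - (n - d))) * 2 ^ (-(j * (a * p))) * 2 ^ (j * (n : ℝ)) *
                2 ^ (-(j : ℝ) * d)) := by
                rw [hrj, ← Real.rpow_natCast, ← Real.rpow_mul two_pos.le, ← Real.rpow_neg two_pos.le,
                  show -(-(j : ℝ) * n) = j * n by ring]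
                ring
            _ = c₂ := by
                rw [← Real.rpow_add two_pos, ← Real.rpow_add two_pos, ← Real.rpow_add two_pos]
                ring_nf
                simp
            _ ≤ c₂ := le_rfl
  have hover : ∀ z, ∑' j, (W j).indicator (fun _ => (1 : ℝ≥0∞)) z ≤ s := by
    intro z
    refine le_trans (le_of_eq ?_) (tsum_indicator_window_le (A := A z) (fun i j hij hj => ?_) s)
    · rfl
    · refine fun h0 => hj (measure_mono_null (cube_mono z ?_) h0)
      exact pow_le_pow_of_le_one (by norm_num) (by norm_num) (by omega)
  calc _ ≤ ∑' j, ENNReal.ofReal c₂ * ∫⁻ z, (W j).indicator (fun _ => 1) z * H z ^ p :=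
        ENNReal.tsum_le_tsum hterm
    _ = ENNReal.ofReal c₂ * ∫⁻ z, (∑' j, (W j).indicator (fun _ => 1) z) * H z ^ p := by
        rw [ENNReal.tsum_mul_left, ← lintegral_tsum fun j => (hWH j).aemeasurable]
        simp only [ENNReal.tsum_mul_right]
    _ ≤ ENNReal.ofReal c₂ * ∫⁻ z, s * H z ^ p := by gcongr with z; exact hover z
    _ = _ := by rw [lintegral_const_mul _ hHp, mul_assoc]

end KeyEstimate

/-! ### The trace -/

section Trace

variable {n : ℕ}

lemma ofReal_abs_setAverage_le (h : E n → ℝ) (y : E n) (r : ℝ) :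
    ENNReal.ofReal |⨍ z in cube y r, h z| ≤ ⨍⁻ z in cube y r, ENNReal.ofReal |h z| ∂volume := by
  rw [setAverage_cube, setLAverage_cube]
  simp only [← Real.enorm_eq_ofReal_abs]
  exact enorm_integral_le_lintegral_enorm _

lemma edist_eq_ofReal_abs (x y : ℝ) : edist x y = ENNReal.ofReal |x - y| := by
  rw [edist_dist, Real.dist_eq]

/-- Successive means differ by at most the approximation of order one by constants. -/
lemma edist_setAverage_le {f : E n → ℝ} (hf : LocallyIntegrable f volume) (y : E n) {r t : ℝ}
    (ht : 0 < t) (hr : t / 2 ≤ r) (hrt : r ≤ t) :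
    edist (⨍ z in cube y r, f z) (⨍ z in cube y t, f z)
      ≤ (2 ^ n + 1) * localApprox volume 1 f y t := by
  have hr0 : 0 < r := by linarith
  refine le_mul_localApprox (by finiteness) fun P hP => ?_
  obtain ⟨c, rfl⟩ : ∃ c, P = MvPolynomial.C c := by
    rcases hP with rfl | hP
    · exact ⟨0, by simp⟩
    · exact ⟨_, MvPolynomial.totalDegree_eq_zero_iff_eq_C.1 (by omega)⟩
  simp only [MvPolynomial.eval_C]
  have hsub : ∀ s : ℝ, 0 < s → edist (⨍ z in cube y s, f z) c
      ≤ ⨍⁻ z in cube y s, ENNReal.ofReal |f z - c| ∂volume := by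
    intro s hs
    have := isProbabilityMeasure_cubeProb y hs
    have h1 : ⨍ z in cube y s, (f z - c) = (⨍ z in cube y s, f z) - c := by
      rw [setAverage_cube, setAverage_cube,
        integral_sub (integrable_cubeProb hf y hs) (integrable_const c)]
      simp
    rw [edist_eq_ofReal_abs, ← h1]
    exact ofReal_abs_setAverage_le _ y s
  calc _ ≤ edist (⨍ z in cube y r, f z) c + edist (⨍ z in cube y t, f z) c := by
        rw [edist_comm (⨍ z in cube y t, f z)]; exact edist_triangle _ _ _
    _ ≤ ENNReal.ofReal (t / r) ^ n * ⨍⁻ z in cube y t, ENNReal.ofReal |f z - c| ∂volume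
        + ⨍⁻ z in cube y t, ENNReal.ofReal |f z - c| ∂volume :=
        add_le_add ((hsub r hr0).trans (setLAverage_cube_le _ hr0 ht (cube_mono y hrt)))
          (hsub t ht)
    _ ≤ 2 ^ n * ⨍⁻ z in cube y t, ENNReal.ofReal |f z - c| ∂volume
        + ⨍⁻ z in cube y t, ENNReal.ofReal |f z - c| ∂volume := by
        gcongr
        rw [← ENNReal.ofReal_ofNat 2]
        refine ENNReal.ofReal_le_ofReal ?_
        rw [div_le_iff₀ hr0]; linarith
    _ = _ := by ring

/-- The trace exists wherever the approximations by constants at dyadic scales are summable. -/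
lemma strictlyDefinedAt_of_tsum_ne_top {f : E n → ℝ} (hf : LocallyIntegrable f volume) {y : E n}
    (h : ∑' j : ℕ, localApprox volume 1 f y ((1 / 2) ^ j) ≠ ∞) : StrictlyDefinedAt f y := by
  set e : ℕ → ℝ≥0∞ := fun j => localApprox volume 1 f y ((1 / 2) ^ j)
  have he : Tendsto (fun j => (2 ^ n + 1) * e j) atTop (𝓝 0) := by
    have := ENNReal.Tendsto.const_mul (a := 2 ^ n + 1) (ENNReal.tendsto_atTop_zero_of_tsum_ne_top h)
      (Or.inr (by finiteness))
    rwa [mul_zero] at this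
  have hsum : ∑' j, (2 ^ n + 1) * e j ≠ ∞ := by
    rw [ENNReal.tsum_mul_left]; exact ENNReal.mul_ne_top (by finiteness) h
  have hc : CauchySeq fun j : ℕ => ⨍ z in cube y ((1 / 2) ^ j), f z := by
    refine cauchySeq_of_edist_le_of_tsum_ne_top _ (fun j => ?_) hsum
    rw [edist_comm]
    refine edist_setAverage_le hf y (by positivity) (le_of_eq ?_) ?_
    · rw [pow_succ]; ring
    · exact pow_le_pow_of_le_one (by norm_num) (by norm_num) (by omega)
  obtain ⟨l, hl⟩ := cauchySeq_tendsto_of_complete hc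
  refine ⟨l, EMetric.tendsto_nhds.2 fun ε hε => ?_⟩
  have hε2 : 0 < ε / 2 := ENNReal.half_pos hε.ne'
  obtain ⟨J, hJ⟩ := ((EMetric.tendsto_nhds.1 hl (ε / 2) hε2).and
    (he.eventually (gt_mem_nhds hε2))).exists_forall_of_atTop
  filter_upwards [Ioc_mem_nhdsGT (show (0 : ℝ) < (1 / 2) ^ J by positivity)] with r hr
  have hJ1 : (1 / 2 : ℝ) ^ J ≤ 1 := pow_le_one₀ (by norm_num) (by norm_num)
  obtain ⟨j, hj1, hj2⟩ := exists_nat_pow_near_of_lt_one hr.1 (hr.2.trans hJ1)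
    (by norm_num : (0 : ℝ) < 1 / 2) (by norm_num)
  have hJj : J ≤ j := by
    by_contra! hlt
    have : (1 / 2 : ℝ) ^ J ≤ (1 / 2) ^ (j + 1) :=
      pow_le_pow_of_le_one (by norm_num) (by norm_num) hlt
    linarith [hr.2]
  calc _ ≤ edist (⨍ z in cube y r, f z) (⨍ z in cube y ((1 / 2) ^ j), f z)
        + edist (⨍ z in cube y ((1 / 2) ^ j), f z) l := edist_triangle _ _ _
    _ < ε / 2 + ε / 2 := by
        refine ENNReal.add_lt_add (lt_of_le_of_lt ?_ (hJ j hJj).2) (hJ j hJj).1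
        refine edist_setAverage_le hf y (by positivity) ?_ hj2
        rw [pow_succ] at hj1; linarith
    _ = ε := ENNReal.add_halves ε

/-- Weights for which the combination of the values at `1, 1 / 2, …, 1 / k` recovers the value
at `0` of every polynomial of degree less than `k`. -/
lemma exists_extrapolation (k : ℕ) : ∃ w : ℕ → ℝ, ∀ p : Polynomial ℝ, p.degree < k →
    ∑ s ∈ Finset.range k, w s * p.eval (1 / ((s : ℝ) + 1)) = p.eval 0 := by
  let v : ℕ → ℝ := fun s => 1 / ((s : ℝ) + 1)
  have hv : InjOn v (Finset.range k : Set ℕ) := by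
    intro s _ t _ hst
    have : (s : ℝ) + 1 = t + 1 := by simpa [v] using hst
    exact_mod_cast add_right_cancel this
  refine ⟨fun s => (Lagrange.basis (Finset.range k) v s).eval 0, fun p hp => ?_⟩
  conv_rhs => rw [Lagrange.eq_interpolate hv (f := p) (by simpa using hp)]
  rw [Lagrange.interpolate_apply, Polynomial.eval_finsetSum]
  refine Finset.sum_congr rfl fun s _ => ?_
  rw [Polynomial.eval_mul, Polynomial.eval_C, mul_comm]

/-- A combination of means over concentric cubes which reproduces the value at the centre of
every polynomial of degree less than `k`. -/
lemma sum_setAverage_eval {k : ℕ} {w : ℕ → ℝ}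
    (hw : ∀ p : Polynomial ℝ, p.degree < k →
      ∑ s ∈ Finset.range k, w s * p.eval (1 / ((s : ℝ) + 1)) = p.eval 0)
    {P : MvPolynomial (Fin n) ℝ} (hP : P ∈ polysBelow n k) (y : E n) {r : ℝ} (hr : 0 < r) :
    ∑ s ∈ Finset.range k, w s * ⨍ z in cube y (r / (s + 1)), MvPolynomial.eval (fun i => z i) P
      = MvPolynomial.eval (fun i => y i) P := by
  have hprob := isProbabilityMeasure_cubeProb (0 : E n) one_pos
  have hline : ∀ u : E n, ∑ s ∈ Finset.range k,
      w s * MvPolynomial.eval (fun i => (y + (r / ((s : ℝ) + 1)) • u) i) P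
        = MvPolynomial.eval (fun i => y i) P := by
    intro u
    let g : Fin n → Polynomial ℝ := fun i =>
      Polynomial.C (y i) + Polynomial.C (r * u i) * Polynomial.X
    have heval : ∀ τ : ℝ, (MvPolynomial.aeval g P).eval τ
        = MvPolynomial.eval (fun i => y i + r * u i * τ) P := by
      intro τ
      rw [← Polynomial.coe_evalRingHom, MvPolynomial.map_aeval]
      simp only [MvPolynomial.eval, g]
      congr 1
      ext <;> simp
    have hdeg : (MvPolynomial.aeval g P).degree < k := by
      rcases hP with rfl | hP
      · simp
      · refine Polynomial.degree_le_natDegree.trans_lt ?_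
        have h1 := MvPolynomial.aeval_natDegree_le P le_rfl g (n := 1) fun i => by
          simp only [g]; compute_degree
        exact_mod_cast h1.trans_lt (by omega)
    have h2 := hw _ hdeg
    simp only [heval] at h2
    simp only [mul_zero, add_zero] at h2
    rw [← h2]
    refine Finset.sum_congr rfl fun s _ => ?_
    congr 3
    funext i
    simp only [PiLp.add_apply, PiLp.smul_apply, smul_eq_mul]
    ring
  calc _ = ∑ s ∈ Finset.range k, ∫ u : E n, w s *
        MvPolynomial.eval (fun i => (y + (r / ((s : ℝ) + 1)) • u) i) P ∂(cubeProb 0 1) := by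
        refine Finset.sum_congr rfl fun s _ => ?_
        rw [integral_const_mul]
        congr 1
        have h3 := setAverage_affine (fun z => MvPolynomial.eval (fun i => z i) P) y
          (ρ := r / (s + 1)) (s := 1) (by positivity) one_pos
        rw [mul_one] at h3
        rw [h3, setAverage_cube]
    _ = ∫ u : E n, ∑ s ∈ Finset.range k, w s *
        MvPolynomial.eval (fun i => (y + (r / ((s : ℝ) + 1)) • u) i) P ∂(cubeProb 0 1) := by
        rw [integral_finsetSum]
        intro s _
        refine Integrable.const_mul ?_ _
        refine integrable_cubeProb (Continuous.locallyIntegrable ?_) 0 one_pos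
        exact (continuous_eval P).comp (by fun_prop)
    _ = _ := by
        simp only [hline]
        simp

/-- Pointwise estimate of the trace: it differs from a polynomial `P` of degree less than `k` by at
most the mean of `|f - P|` over a cube and the approximations of order `k` at all smaller scales.
The combinations of means that reproduce polynomials of degree less than `k` converge to the trace,
and two successive ones differ by at most a multiple of the approximation of order `k`. -/
lemma exists_sub_eval_le (n : ℕ) {k : ℕ} (hk : 1 ≤ k) : ∃ C : ℝ≥0, ∀ f : E n → ℝ,
    LocallyIntegrable f volume → ∀ (y : E n) (l : ℝ),
    Tendsto (fun r : ℝ => ⨍ z in cube y r, f z) (𝓝[>] 0) (𝓝 l) →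
    ∀ P ∈ polysBelow n k, ∀ i : ℕ,
      ENNReal.ofReal |l - MvPolynomial.eval (fun i => y i) P| ≤
        C * (⨍⁻ z in cube y ((1 / 2) ^ i),
            ENNReal.ofReal |f z - MvPolynomial.eval (fun i => z i) P| ∂volume
          + ∑' j : ℕ, localApprox volume k f y ((1 / 2) ^ (i + j))) := by
  obtain ⟨w, hw⟩ := exists_extrapolation k
  set B : ℝ≥0 := ∑ s ∈ Finset.range k, Real.toNNReal |w s| * ((s : ℝ≥0) + 1) ^ n with hB
  refine ⟨B * (2 ^ n + 1), fun f hf y l hl P hP i => ?_⟩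
  let T : ℝ → ℝ := fun r => ∑ s ∈ Finset.range k, w s * ⨍ z in cube y (r / (s + 1)), f z
  have hT : ∀ r : ℝ, 0 < r → ∀ Q ∈ polysBelow n k,
      edist (T r) (MvPolynomial.eval (fun i => y i) Q) ≤ B * ⨍⁻ z in cube y r,
        ENNReal.ofReal |f z - MvPolynomial.eval (fun i => z i) Q| ∂volume := by
    intro r hr Q hQ
    set h : E n → ℝ := fun z => f z - MvPolynomial.eval (fun i => z i) Q with hh
    have h1 : T r - MvPolynomial.eval (fun i => y i) Q
        = ∑ s ∈ Finset.range k, w s * ⨍ z in cube y (r / (s + 1)), h z := by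
      rw [← sum_setAverage_eval hw hQ y hr, ← Finset.sum_sub_distrib]
      refine Finset.sum_congr rfl fun s _ => ?_
      have hrs : 0 < r / ((s : ℝ) + 1) := by positivity
      rw [← mul_sub]
      simp only [setAverage_cube, hh]
      rw [integral_sub (integrable_cubeProb hf y hrs)
        (integrable_cubeProb (continuous_eval Q).locallyIntegrable y hrs)]
    rw [edist_eq_ofReal_abs, h1]
    calc _ ≤ ENNReal.ofReal (∑ s ∈ Finset.range k, |w s * ⨍ z in cube y (r / (s + 1)), h z|) :=
          ENNReal.ofReal_le_ofReal (Finset.abs_sum_le_sum_abs _ _)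
      _ = ∑ s ∈ Finset.range k, ENNReal.ofReal |w s| *
            ENNReal.ofReal |⨍ z in cube y (r / (s + 1)), h z| := by
          rw [ENNReal.ofReal_sum_of_nonneg fun _ _ => abs_nonneg _]
          refine Finset.sum_congr rfl fun s _ => ?_
          rw [abs_mul, ENNReal.ofReal_mul (abs_nonneg _)]
      _ ≤ ∑ s ∈ Finset.range k, ENNReal.ofReal |w s| * (((s : ℝ≥0∞) + 1) ^ n *
            ⨍⁻ z in cube y r, ENNReal.ofReal |h z| ∂volume) := by
          gcongr with s _
          have hs1 : (1 : ℝ) ≤ (s : ℝ) + 1 := by simp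
          refine (ofReal_abs_setAverage_le h y _).trans
            ((setLAverage_cube_le _ (by positivity) hr (cube_mono y (div_le_self hr.le hs1))).trans
              (le_of_eq ?_))
          congr 2
          rw [show r / (r / ((s : ℝ) + 1)) = s + 1 by field_simp,
            ENNReal.ofReal_add (by positivity) one_pos.le]
          simp
      _ = _ := by
          rw [hB, ENNReal.ofNNReal_finsetSum, Finset.sum_mul]
          refine Finset.sum_congr rfl fun s _ => ?_
          rw [← mul_assoc]
          congr 1
  have hTl : Tendsto T (𝓝[>] 0) (𝓝 l) := by
    have hsum : ∑ s ∈ Finset.range k, w s * l = l := by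
      have := hw 1 (by rw [Polynomial.degree_one]; exact_mod_cast hk)
      rw [← Finset.sum_mul]
      simpa using congrArg (· * l) this
    rw [← hsum]
    refine tendsto_finsetSum _ fun s _ => (hl.comp ?_).const_mul _
    refine tendsto_nhdsWithin_iff.2 ⟨?_, ?_⟩
    · have : Tendsto (fun r : ℝ => r / ((s : ℝ) + 1)) (𝓝 0) (𝓝 (0 / ((s : ℝ) + 1))) :=
        tendsto_id.div_const _
      rw [zero_div] at this
      exact this.mono_left nhdsWithin_le_nhds
    · filter_upwards [self_mem_nhdsWithin] with r (hr : 0 < r)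
      exact mem_Ioi.2 (by positivity)
  have hpow : Tendsto (fun j : ℕ => (1 / 2 : ℝ) ^ (i + j)) atTop (𝓝[>] 0) := by
    refine tendsto_nhdsWithin_iff.2 ⟨?_, Eventually.of_forall fun j => mem_Ioi.2 (by positivity)⟩
    have := (tendsto_pow_atTop_nhds_zero_of_lt_one (r := (1 / 2 : ℝ)) (by norm_num) (by norm_num))
    exact this.comp (tendsto_add_atTop_nat i |>.congr fun j => add_comm j i)
  have hstep : ∀ j : ℕ, edist (T ((1 / 2) ^ (i + j))) (T ((1 / 2) ^ (i + (j + 1))))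
      ≤ B * (2 ^ n + 1) * localApprox volume k f y ((1 / 2) ^ (i + j)) := by
    intro j
    refine le_mul_localApprox (by finiteness) fun Q hQ => ?_
    have hr0 : (0 : ℝ) < (1 / 2) ^ (i + j) := by positivity
    have hr1 : (0 : ℝ) < (1 / 2) ^ (i + (j + 1)) := by positivity
    have hle : (1 / 2 : ℝ) ^ (i + (j + 1)) ≤ (1 / 2) ^ (i + j) :=
      pow_le_pow_of_le_one (by norm_num) (by norm_num) (by omega)
    have hc := setLAverage_cube_le
      (fun z : E n => ENNReal.ofReal |f z - MvPolynomial.eval (fun i => z i) Q|) hr1 hr0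
      (cube_mono y hle)
    rw [show (1 / 2 : ℝ) ^ (i + j) / (1 / 2) ^ (i + (j + 1)) = 2 by
      rw [← add_assoc, pow_succ]; field_simp, ENNReal.ofReal_ofNat] at hc
    calc _ ≤ edist (T ((1 / 2) ^ (i + j))) (MvPolynomial.eval (fun i => y i) Q)
          + edist (T ((1 / 2) ^ (i + (j + 1)))) (MvPolynomial.eval (fun i => y i) Q) := by
          rw [edist_comm (T ((1 / 2) ^ (i + (j + 1))))]; exact edist_triangle _ _ _
      _ ≤ _ := add_le_add (hT _ hr0 Q hQ) ((hT _ hr1 Q hQ).trans (mul_le_mul_right hc _))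
      _ = _ := by ring
  have hlim := edist_le_tsum_of_edist_le_of_tendsto₀ _ hstep (hTl.comp hpow)
  rw [ENNReal.tsum_mul_left, add_zero] at hlim
  rw [← edist_eq_ofReal_abs]
  calc _ ≤ edist l (T ((1 / 2) ^ i)) + edist (T ((1 / 2) ^ i)) (MvPolynomial.eval (fun i => y i) P) :=
        edist_triangle _ _ _
    _ ≤ B * (2 ^ n + 1) * ∑' j : ℕ, localApprox volume k f y ((1 / 2) ^ (i + j))
        + B * 1 * ⨍⁻ z in cube y ((1 / 2) ^ i),
            ENNReal.ofReal |f z - MvPolynomial.eval (fun i => z i) P| ∂volume := by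
        rw [edist_comm l, mul_one]
        exact add_le_add hlim (hT _ (by positivity) P hP)
    _ ≤ B * (2 ^ n + 1) * ∑' j : ℕ, localApprox volume k f y ((1 / 2) ^ (i + j))
        + B * (2 ^ n + 1) * ⨍⁻ z in cube y ((1 / 2) ^ i),
            ENNReal.ofReal |f z - MvPolynomial.eval (fun i => z i) P| ∂volume := by
        gcongr; exact le_add_self
    _ = _ := by push_cast; ring

/-- The trace is almost everywhere measurable: it is a limit of means over cubes of fixed radii. -/
lemma aemeasurable_trace {f : E n → ℝ} (hf : AEStronglyMeasurable f volume) {μ : Measure (E n)}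
    (h : ∀ᵐ x ∂μ, StrictlyDefinedAt f x) : AEMeasurable (trace f) μ := by
  have hmeas : ∀ j : ℕ, Measurable fun x => ⨍ y in cube x ((1 / 2) ^ j), f y := by
    intro j
    have h1 : ∀ x : E n, ⨍ y in cube x ((1 / 2) ^ j), f y
        = ((ENNReal.ofReal (2 * (1 / 2) ^ j) ^ n)⁻¹).toReal *
          ∫ y, ({z : E n × E n | z.2 ∈ cube z.1 ((1 / 2) ^ j)}.indicator
            fun z => hf.mk f z.2) (x, y) := by
      intro x
      rw [setAverage_cube, integral_congr_ae ((cubeProb_absolutelyContinuous x _).ae_eq hf.ae_eq_mk),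
        cubeProb, integral_smul_measure, volume_cube, smul_eq_mul,
        ← integral_indicator (measurableSet_cube x _)]
      rfl
    simp only [h1]
    have h2 : StronglyMeasurable ({z : E n × E n | z.2 ∈ cube z.1 ((1 / 2) ^ j)}.indicator
        fun z => hf.mk f z.2) :=
      (hf.stronglyMeasurable_mk.comp_measurable measurable_snd).indicator (measurableSet_cube_prod _)
    exact (h2.integral_prod_right'.measurable).const_mul _
  refine aemeasurable_of_tendsto_metrizable_ae atTop (fun j => (hmeas j).aemeasurable) ?_
  filter_upwards [h] with x hx
  obtain ⟨l, hl⟩ := hx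
  have hpow : Tendsto (fun j : ℕ => (1 / 2 : ℝ) ^ j) atTop (𝓝[>] 0) :=
    tendsto_nhdsWithin_iff.2
      ⟨tendsto_pow_atTop_nhds_zero_of_lt_one (by norm_num) (by norm_num),
        Eventually.of_forall fun j => mem_Ioi.2 (by positivity)⟩
  rw [trace, hl.limUnder_eq]
  exact hl.comp hpow

end Trace

/-! ### The trace estimate -/

section Main

variable {n : ℕ} {d : ℝ} {S : Set (E n)} {μ : Measure (E n)} {c₁ c₂ : ℝ}

lemma lintegral_cube_rpow_le {φ : E n → ℝ≥0∞} (hφ : AEMeasurable φ volume) {p : ℝ} (hp : 1 < p) :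
    ∫⁻ x, (∫⁻ y in cube x 4, φ y) ^ p ≤ (8 ^ n) ^ p * ∫⁻ y, φ y ^ p := by
  have hvol : ∀ x : E n, volume (cube x 4) = 8 ^ n := fun x => by
    rw [volume_cube]; norm_num
  have hψ := hφ.measurable_mk
  set ψ := hφ.mk φ
  have h1 : ∀ x, ∫⁻ y in cube x 4, φ y = ∫⁻ y in cube x 4, ψ y := fun x =>
    lintegral_congr_ae (ae_restrict_of_ae hφ.ae_eq_mk)
  have h2 : ∫⁻ y, φ y ^ p = ∫⁻ y, ψ y ^ p :=
    lintegral_congr_ae (hφ.ae_eq_mk.mono fun y hy => congrArg (· ^ p) hy)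
  simp only [h1]
  rw [h2]
  calc _ ≤ ∫⁻ x, (8 ^ n) ^ (p - 1) * ∫⁻ y in cube x 4, ψ y ^ p := by
        refine lintegral_mono fun x => ?_
        have := rpow_lintegral_le (volume.restrict (cube x 4)) hψ.aemeasurable hp
        rwa [Measure.restrict_apply_univ, hvol] at this
    _ = (8 ^ n) ^ (p - 1) * ∫⁻ y, ψ y ^ p * 8 ^ n := by
        rw [lintegral_const_mul _ (measurable_setLIntegral_cube (hψ.pow_const p) 4),
          lintegral_setLIntegral_cube (hψ.pow_const p)]
        simp only [hvol]
    _ = _ := by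
        rw [lintegral_mul_const _ (hψ.pow_const p), mul_comm (∫⁻ y, ψ y ^ p), ← mul_assoc]
        congr 1
        nth_rewrite 2 [← ENNReal.rpow_one (8 ^ n : ℝ≥0∞)]
        rw [← ENNReal.rpow_add _ _ (by simp) (by finiteness)]
        ring_nf

/-- The majorant of the local approximations: the smoothness function plus a local mass of `|f|`. -/
def majorant (m : ℕ) (α : ℝ) (q : ℝ≥0∞) (f : E n → ℝ) (x : E n) : ℝ≥0∞ :=
  smoothnessFn m α q f x + ∫⁻ y in cube x 4, ENNReal.ofReal |f y|

lemma aemeasurable_majorant {m : ℕ} {α : ℝ} {q : ℝ≥0∞} {f : E n → ℝ}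
    (hf : AEStronglyMeasurable f volume)
    (hg : AEStronglyMeasurable (smoothnessFn m α q f) volume) :
    AEMeasurable (majorant m α q f) volume := by
  refine hg.aemeasurable.add (Measurable.aemeasurable ?_)
  have h1 : ∀ x, ∫⁻ y in cube x 4, ENNReal.ofReal |f y|
      = ∫⁻ y in cube x 4, ENNReal.ofReal |hf.mk f y| := fun x =>
    lintegral_congr_ae (ae_restrict_of_ae (hf.ae_eq_mk.mono fun y hy => by
      simp only [hy]))
  simp only [h1]
  exact measurable_setLIntegral_cube hf.stronglyMeasurable_mk.measurable.abs.ennreal_ofReal 4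

lemma eLpNorm_ofReal_rpow {X F : Type*} [MeasurableSpace X] [TopologicalSpace F]
    [ContinuousENorm F] {ν : Measure X} {p : ℝ} (hp : 0 < p) (u : X → F) :
    eLpNorm u (ENNReal.ofReal p) ν ^ p = ∫⁻ x, ‖u x‖ₑ ^ p ∂ν := by
  rw [eLpNorm_eq_lintegral_rpow_enorm_toReal (by simpa using hp) ENNReal.ofReal_ne_top,
    ENNReal.toReal_ofReal hp.le, ← ENNReal.rpow_mul, one_div_mul_cancel hp.ne', ENNReal.rpow_one]

lemma exists_lintegral_majorant_le (n : ℕ) {p : ℝ} (hp : 1 < p) :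
    ∃ K : ℝ≥0, ∀ (m : ℕ) (α : ℝ) (q : ℝ≥0∞) (f : E n → ℝ), MemTriebelLizorkin m α p q f →
      ∫⁻ x, majorant m α q f x ^ p ≤ K * triebelLizorkinNorm m α p q f ^ p := by
  have hp0 : 0 < p := by linarith
  have htop : (2 : ℝ≥0∞) ^ (p - 1) * (1 + (8 ^ n) ^ p) ≠ ∞ := by
    refine ENNReal.mul_ne_top (ENNReal.rpow_ne_top_of_nonneg (by linarith) (by finiteness)) ?_
    exact ENNReal.add_ne_top.2 ⟨ENNReal.one_ne_top,
      ENNReal.rpow_ne_top_of_nonneg hp0.le (by finiteness)⟩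
  refine ⟨((2 : ℝ≥0∞) ^ (p - 1) * (1 + (8 ^ n) ^ p)).toNNReal, fun m α q f hf => ?_⟩
  rw [ENNReal.coe_toNNReal htop]
  have hfm : AEMeasurable (fun y => ENNReal.ofReal |f y|) volume :=
    hf.1.aestronglyMeasurable.aemeasurable.abs.ennreal_ofReal
  have h1 : ∫⁻ x, smoothnessFn m α q f x ^ p ≤ triebelLizorkinNorm m α p q f ^ p := by
    have := eLpNorm_ofReal_rpow (ν := volume) hp0 (smoothnessFn m α q f)
    simp only [enorm_eq_self] at this
    rw [← this]
    exact ENNReal.rpow_le_rpow le_add_self hp0.le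
  have h2 : ∫⁻ x, ENNReal.ofReal |f x| ^ p ≤ triebelLizorkinNorm m α p q f ^ p := by
    have := eLpNorm_ofReal_rpow (ν := volume) hp0 f
    simp only [Real.enorm_eq_ofReal_abs] at this
    rw [← this]
    exact ENNReal.rpow_le_rpow le_self_add hp0.le
  calc ∫⁻ x, majorant m α q f x ^ p
      ≤ ∫⁻ x, 2 ^ (p - 1) * (smoothnessFn m α q f x ^ p
          + (∫⁻ y in cube x 4, ENNReal.ofReal |f y|) ^ p) :=
        lintegral_mono fun x => ENNReal.rpow_add_le_mul_rpow_add_rpow _ _ hp.le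
    _ = 2 ^ (p - 1) * ((∫⁻ x, smoothnessFn m α q f x ^ p)
          + ∫⁻ x, (∫⁻ y in cube x 4, ENNReal.ofReal |f y|) ^ p) := by
        rw [lintegral_const_mul' _ _ (ENNReal.rpow_ne_top_of_nonneg (by linarith) (by finiteness)),
          lintegral_add_left' (hf.2.aestronglyMeasurable.aemeasurable.pow_const p)]
    _ ≤ 2 ^ (p - 1) * (triebelLizorkinNorm m α p q f ^ p
          + (8 ^ n) ^ p * triebelLizorkinNorm m α p q f ^ p) := by
        gcongr
        exact (lintegral_cube_rpow_le hfm hp).trans (mul_le_mul_right h2 _)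
    _ = _ := by ring

/-- On `S`, the approximation at scale `2 ^ (-j)` is controlled by the behaviour of the majorant away
from `S` at the same scale. -/
lemma exists_le_awayMean [SFinite μ] {s : ℕ}
    (hs : ∀ y ∈ S, ∀ r : ℝ, 0 < r → r ≤ 1 / 2 →
      volume (cube y r) ≤ 2 * volume (cube y r ∩ {z | μ (cube z ((1 / 2) ^ s * r)) = 0}))
    {m k : ℕ} (hk : 1 ≤ k) (hkm : k ≤ m) {a α p : ℝ} (ha : 0 ≤ a) (haα : a ≤ α) (hak : a < k)
    (hp : 0 < p) :
    ∃ K : ℝ≥0, ∀ q : ℝ≥0∞, 1 ≤ q → ∀ f : E n → ℝ, AEMeasurable f volume →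
      ∀ H : E n → ℝ≥0∞, Measurable H → majorant m α q f =ᵐ[volume] H → ∀ y ∈ S,
        (∀ j : ℕ, localApprox volume k f y (2 * (1 / 2) ^ j)
          ≤ K * awayMean μ s a p H j y ^ (1 / p)) ∧
        ⨍⁻ z in cube y 1, ENNReal.ofReal |f z| ∂volume
          ≤ K * awayMean μ s a p H 0 y ^ (1 / p) := by
  obtain ⟨C, hC⟩ := exists_localApprox_le_majorant n hk hkm ha haα hak
  set C₁ : ℝ≥0∞ := 2 ^ n * C * ENNReal.ofReal (4 ^ a) + 1 with hC₁
  have hC₁top : C₁ ≠ ∞ := by finiteness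
  have hKtop : (2 * C₁ ^ p) ^ (1 / p) ≠ ∞ := by
    refine ENNReal.rpow_ne_top_of_nonneg (by positivity) (ENNReal.mul_ne_top (by finiteness) ?_)
    exact ENNReal.rpow_ne_top_of_nonneg hp.le hC₁top
  refine ⟨((2 * C₁ ^ p) ^ (1 / p)).toNNReal, fun q hq f hf H hH hHeq y hy => ?_⟩
  rw [ENNReal.coe_toNNReal hKtop]
  have hroot : ∀ (j : ℕ) (v : ℝ≥0∞), (∀ᵐ z, z ∈ cube y ((1 / 2) ^ (j + 1)) →
      v ≤ C₁ * (ENNReal.ofReal (2 ^ (-(j * a))) * H z)) →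
      v ≤ (2 * C₁ ^ p) ^ (1 / p) * awayMean μ s a p H j y ^ (1 / p) := by
    intro j v hv
    have h := ENNReal.rpow_le_rpow (rpow_le_awayMean hs hp hH hy hv) (z := 1 / p) (by positivity)
    rwa [← ENNReal.rpow_mul, mul_one_div_cancel hp.ne', ENNReal.rpow_one,
      ENNReal.mul_rpow_of_nonneg _ _ (by positivity)] at h
  refine ⟨fun j => hroot j _ ?_, hroot 0 _ ?_⟩
  · -- The cube of radius `2 * 2 ^ (-j)` about `y` lies in the cube of radius `4 * 2 ^ (-j)` about any
    -- such `z`; with `j = 0` this is the reason why the majorant uses cubes of radius `4`.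
    filter_upwards [hHeq] with z hz hzy
    set t : ℝ := 4 * (1 / 2) ^ j with ht
    have ht0 : 0 < t := by positivity
    have ht4 : t ≤ 4 := by
      have : (1 / 2 : ℝ) ^ j ≤ 1 := pow_le_one₀ (by norm_num) (by norm_num)
      linarith
    have hsub : cube y (2 * (1 / 2) ^ j) ⊆ cube z t := by
      refine cube_subset_cube (mem_cube_comm.1 hzy) ?_
      have : (0 : ℝ) < (1 / 2) ^ j := by positivity
      rw [ht, pow_succ]; linarith
    have h1 := localApprox_le_of_subset k f (by positivity) ht0 hsub
    rw [ht, show 4 * (1 / 2 : ℝ) ^ j / (2 * (1 / 2) ^ j) = 2 by field_simp; norm_num,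
      ENNReal.ofReal_ofNat, ← ht] at h1
    have h2 := hC q hq f hf z t ht0 ht4
    have h3 : localApprox volume k f z t
        = ENNReal.ofReal (t ^ a) * (ENNReal.ofReal (t ^ (-a)) * localApprox volume k f z t) := by
      rw [← mul_assoc, ← ENNReal.ofReal_mul (by positivity), ← Real.rpow_add ht0]
      simp
    have h4 : t ^ a = 4 ^ a * 2 ^ (-(j * a)) := by
      rw [ht, Real.mul_rpow (by positivity) (by positivity), ← Real.rpow_natCast, one_div,
        Real.inv_rpow two_pos.le, ← Real.rpow_neg two_pos.le, ← Real.rpow_mul two_pos.le]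
      congr 2; ring
    calc _ ≤ 2 ^ n * localApprox volume k f z t := h1
      _ ≤ 2 ^ n * (ENNReal.ofReal (t ^ a) * (C * H z)) := by
          rw [h3, ← hz]
          exact mul_le_mul_right (mul_le_mul_right h2 _) _
      _ = 2 ^ n * C * ENNReal.ofReal (4 ^ a) * (ENNReal.ofReal (2 ^ (-(j * a))) * H z) := by
          rw [h4, ENNReal.ofReal_mul (by positivity)]; ring
      _ ≤ _ := mul_le_mul_left le_self_add _
  · filter_upwards [hHeq] with z hz hzy
    calc _ ≤ 1 * ∫⁻ z in cube y 1, ENNReal.ofReal |f z| := by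
          rw [setLAverage_cube_eq]
          refine mul_le_mul_left (ENNReal.inv_le_one.2 ?_) _
          rw [volume_cube]
          exact one_le_pow₀ (by rw [ENNReal.one_le_ofReal]; norm_num)
      _ ≤ ∫⁻ v in cube z 4, ENNReal.ofReal |f v| := by
          rw [one_mul]
          exact lintegral_mono_set (cube_subset_cube (mem_cube_comm.1 hzy) (by norm_num))
      _ ≤ H z := by rw [← hz]; exact le_add_self
      _ = 1 * (ENNReal.ofReal (2 ^ (-(((0 : ℕ) : ℝ) * a))) * H z) := by simp
      _ ≤ _ := mul_le_mul_left le_add_self _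

/-- The sum over the scales `j ≥ i` of the quantities `awayMean ^ (1 / p)`. -/
def tailSum (μ : Measure (E n)) (s : ℕ) (a p : ℝ) (H : E n → ℝ≥0∞) (i : ℕ) (y : E n) : ℝ≥0∞ :=
  ∑' l : ℕ, awayMean μ s a p H (i + l) y ^ (1 / p)

lemma measurable_tailSum (μ : Measure (E n)) [SFinite μ] (s : ℕ) (a p : ℝ) {H : E n → ℝ≥0∞}
    (hH : Measurable H) (i : ℕ) : Measurable (tailSum μ s a p H i) :=
  Measurable.tsum fun l => (measurable_awayMean μ s a p hH (i + l)).pow_const _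

lemma awayMean_le_tailSum (μ : Measure (E n)) (s : ℕ) (a p : ℝ) (H : E n → ℝ≥0∞) (i : ℕ) (y : E n) :
    awayMean μ s a p H i y ^ (1 / p) ≤ tailSum μ s a p H i y :=
  ENNReal.le_tsum (f := fun l => awayMean μ s a p H (i + l) y ^ (1 / p)) 0

lemma IsRegular.exists_tsum_lintegral_tailSum_le [SFinite μ] (h : IsRegular d S μ c₁ c₂)
    (hd : 0 < d) (s : ℕ) {a p : ℝ} (hp : 1 < p) (hap : 0 < a * p - (n - d)) :
    ∃ K : ℝ≥0, ∀ H : E n → ℝ≥0∞, Measurable H →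
      ∑' i : ℕ, ENNReal.ofReal (2 ^ (i * (a * p - (n - d)))) * ∫⁻ y, tailSum μ s a p H i y ^ p ∂μ
        ≤ K * ∫⁻ z, H z ^ p := by
  obtain ⟨K, hK⟩ := exists_hardy hp hap
  refine ⟨K * (Real.toNNReal c₂ * s), fun H hH => ?_⟩
  have hU : ∀ i : ℕ, Measurable fun y => tailSum μ s a p H i y ^ p := fun i =>
    (measurable_tailSum μ s a p hH i).pow_const p
  calc _ = ∫⁻ y, ∑' i : ℕ, ENNReal.ofReal (2 ^ (i * (a * p - (n - d)))) *
        tailSum μ s a p H i y ^ p ∂μ := by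
        rw [lintegral_tsum fun i => ((hU i).const_mul _).aemeasurable]
        exact tsum_congr fun i => (lintegral_const_mul _ (hU i)).symm
    _ ≤ ∫⁻ y, K * ∑' j : ℕ, ENNReal.ofReal (2 ^ (j * (a * p - (n - d)))) *
        awayMean μ s a p H j y ∂μ := lintegral_mono fun y => hK fun j => awayMean μ s a p H j y
    _ = K * ∑' j : ℕ, ENNReal.ofReal (2 ^ (j * (a * p - (n - d)))) *
        ∫⁻ y, awayMean μ s a p H j y ∂μ := by
        have hb : ∀ j, Measurable fun y => awayMean μ s a p H j y := measurable_awayMean μ s a p hH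
        rw [lintegral_const_mul' _ _ ENNReal.coe_ne_top,
          lintegral_tsum fun j => ((hb j).const_mul _).aemeasurable]
        exact congrArg _ (tsum_congr fun j => lintegral_const_mul _ (hb j))
    _ ≤ K * (ENNReal.ofReal c₂ * s * ∫⁻ z, H z ^ p) := by
        gcongr; exact h.tsum_lintegral_awayMean_le hd s a p hH
    _ = _ := by push_cast; rw [ENNReal.ofReal]; ring

lemma localApprox_dyadic_le (k : ℕ) (f : E n → ℝ) (y : E n) (j : ℕ) :
    localApprox volume k f y ((1 / 2) ^ j) ≤ 2 ^ n * localApprox volume k f y (2 * (1 / 2) ^ j) := by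
  have hr : (0 : ℝ) < (1 / 2) ^ j := by positivity
  have h := localApprox_le_of_subset k f hr (by positivity : (0 : ℝ) < 2 * (1 / 2) ^ j)
    (cube_mono y (by linarith))
  rwa [mul_div_cancel_right₀ _ hr.ne', ENNReal.ofReal_ofNat] at h

lemma tsum_localApprox_le {k s : ℕ} {a p : ℝ} {K : ℝ≥0} {f : E n → ℝ} {H : E n → ℝ≥0∞} {y : E n}
    (hK : ∀ j : ℕ, localApprox volume k f y (2 * (1 / 2) ^ j)
      ≤ K * awayMean μ s a p H j y ^ (1 / p)) (i : ℕ) :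
    ∑' j : ℕ, localApprox volume k f y ((1 / 2) ^ (i + j))
      ≤ 2 ^ n * K * tailSum μ s a p H i y := by
  rw [tailSum, ← ENNReal.tsum_mul_left]
  refine ENNReal.tsum_le_tsum fun j => (localApprox_dyadic_le k f y (i + j)).trans ?_
  rw [mul_assoc]
  exact mul_le_mul_right (hK _) _

/-- The trace exists almost everywhere on `S`. Only approximation by constants is used, with a
smoothness exponent `a` between `(n - d) / p` and `1`;
this is possible because `(n - d) / p < 1`. -/
lemma IsRegular.ae_strictlyDefinedAt [SFinite μ] (h : IsRegular d S μ c₁ c₂) (hd : 0 < d)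
    (hdn : d < n) (hd1 : (n : ℝ) - 1 < d) {p : ℝ} (hp : 1 < p) {α : ℝ} (hα : ((n : ℝ) - d) / p < α)
    {m : ℕ} (hm : 1 ≤ m) {q : ℝ≥0∞} (hq : 1 ≤ q) {f : E n → ℝ}
    (hf : MemTriebelLizorkin m α p q f) : ∀ᵐ y ∂μ, StrictlyDefinedAt f y := by
  have hp0 : 0 < p := by linarith
  have hnd : ((n : ℝ) - d) / p < 1 := by rw [div_lt_one hp0]; linarith
  have hnd0 : 0 < ((n : ℝ) - d) / p := div_pos (by linarith) hp0
  obtain ⟨a, ha1, ha2⟩ := exists_between (lt_min hα hnd)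
  have haα : a ≤ α := ha2.le.trans (min_le_left _ _)
  have ha1' : a < (1 : ℕ) := by simpa using ha2.trans_le (min_le_right _ _)
  obtain ⟨s, hs⟩ := h.exists_porosity hdn
  obtain ⟨K, hK⟩ := exists_le_awayMean hs le_rfl hm (hnd0.trans ha1).le haα ha1' hp0
  obtain ⟨K', hK'⟩ := h.exists_tsum_lintegral_tailSum_le hd s hp (a := a)
    (by rw [div_lt_iff₀ hp0] at ha1; linarith)
  obtain ⟨K'', hK''⟩ := exists_lintegral_majorant_le n hp
  have hHm := aemeasurable_majorant hf.1.aestronglyMeasurable hf.2.aestronglyMeasurable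
  set H := hHm.mk _
  have hH : Measurable H := hHm.measurable_mk
  have hHint : ∫⁻ z, H z ^ p ≠ ∞ := by
    rw [← lintegral_congr_ae (hHm.ae_eq_mk.mono fun y hy => congrArg (· ^ p) hy)]
    refine ne_top_of_le_ne_top (ENNReal.mul_ne_top ENNReal.coe_ne_top ?_) (hK'' m α q f hf)
    exact ENNReal.rpow_ne_top_of_nonneg hp0.le
      (ENNReal.add_ne_top.2 ⟨hf.1.eLpNorm_ne_top, hf.2.eLpNorm_ne_top⟩)
  have hU : ∫⁻ y, tailSum μ s a p H 0 y ^ p ∂μ ≠ ∞ := by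
    refine ne_top_of_le_ne_top (ENNReal.mul_ne_top ENNReal.coe_ne_top hHint)
      (le_trans ?_ (hK' H hH))
    refine le_trans (le_of_eq ?_) (ENNReal.le_tsum 0)
    simp
  have hfin := ae_lt_top ((measurable_tailSum μ s a p hH 0).pow_const p) hU
  have hS : ∀ᵐ x ∂μ, x ∈ S := h.null_compl
  have hloc : LocallyIntegrable f volume := hf.1.locallyIntegrable (by simpa using hp.le)
  filter_upwards [hfin, hS] with y hy hyS
  refine strictlyDefinedAt_of_tsum_ne_top hloc ?_
  have hb := (hK q hq f hf.1.aestronglyMeasurable.aemeasurable H hH hHm.ae_eq_mk y hyS).1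
  have hsum := tsum_localApprox_le hb 0
  simp only [zero_add] at hsum
  refine ne_top_of_le_ne_top (ENNReal.mul_ne_top (by finiteness) ?_) hsum
  intro htop
  rw [htop, ENNReal.top_rpow_of_pos hp0] at hy
  exact lt_irrefl _ hy

lemma setLAverage_le_add_mul {A : Set (E n)} (hA : MeasurableSet A) {F U : E n → ℝ≥0∞}
    (hU : Measurable U) {b c : ℝ≥0∞} (h : ∀ᵐ y ∂μ, y ∈ A → F y ≤ b + c * U y) :
    ⨍⁻ y in A, F y ∂μ ≤ b + c * ⨍⁻ y in A, U y ∂μ := by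
  calc ⨍⁻ y in A, F y ∂μ ≤ ⨍⁻ y in A, (b + c * U y) ∂μ := by
        refine lintegral_mono_ae (Measure.ae_smul_measure ?_ _)
        exact (ae_restrict_iff' hA).2 h
    _ = ⨍⁻ _ in A, b ∂μ + c * ⨍⁻ y in A, U y ∂μ := by
        simp only [laverage]
        rw [lintegral_add_left measurable_const, lintegral_const_mul _ hU]
    _ ≤ _ := by
        gcongr
        rw [laverage, lintegral_const, Measure.smul_apply, smul_eq_mul]
        exact mul_le_of_le_one_right' (ENNReal.inv_mul_le_one _)

/-- The trace and its local approximations on `S` in terms of the tail sums. -/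
lemma exists_trace_le (n : ℕ) {k : ℕ} (hk : 1 ≤ k) (K : ℝ≥0) : ∃ D : ℝ≥0,
    ∀ (S : Set (E n)) (μ : Measure (E n)) [SFinite μ], μ Sᶜ = 0 →
    ∀ (s : ℕ) (a p : ℝ) (f : E n → ℝ) (H : E n → ℝ≥0∞), Measurable H →
      LocallyIntegrable f volume → (∀ᵐ y ∂μ, StrictlyDefinedAt f y) →
      (∀ y ∈ S, (∀ j : ℕ, localApprox volume k f y (2 * (1 / 2) ^ j)
          ≤ K * awayMean μ s a p H j y ^ (1 / p)) ∧
        ⨍⁻ z in cube y 1, ENNReal.ofReal |f z| ∂volume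
          ≤ K * awayMean μ s a p H 0 y ^ (1 / p)) →
      (∀ᵐ y ∂μ, ENNReal.ofReal |trace f y| ≤ D * tailSum μ s a p H 0 y) ∧
      ∀ x ∈ S, ∀ i : ℕ, localApprox μ k (trace f) x ((1 / 2) ^ i)
        ≤ D * (tailSum μ s a p H i x + ⨍⁻ y in cube x ((1 / 2) ^ i), tailSum μ s a p H i y ∂μ) := by
  obtain ⟨C, hC⟩ := exists_sub_eval_le n hk
  refine ⟨C * (2 ^ n * K) + C * K, fun S μ _ hS s a p f H hH hf hex hK => ?_⟩
  have hSae : ∀ᵐ y ∂μ, y ∈ S := hS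
  have htrace : ∀ᵐ y ∂μ, ∀ P ∈ polysBelow n k, ∀ i : ℕ,
      ENNReal.ofReal |trace f y - MvPolynomial.eval (fun i => y i) P| ≤
        C * (⨍⁻ z in cube y ((1 / 2) ^ i),
            ENNReal.ofReal |f z - MvPolynomial.eval (fun i => z i) P| ∂volume
          + 2 ^ n * K * tailSum μ s a p H i y) := by
    filter_upwards [hex, hSae] with y hy hyS P hP i
    obtain ⟨l, hl⟩ := hy
    rw [trace, hl.limUnder_eq]
    exact (hC f hf y l hl P hP i).trans
      (mul_le_mul_right (add_le_add_right (tsum_localApprox_le (hK y hyS).1 i) _) _)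
  constructor
  · filter_upwards [htrace, hSae] with y hy hyS
    have h0 := hy 0 (zero_mem_polysBelow k) 0
    simp only [map_zero, sub_zero, pow_zero] at h0
    calc _ ≤ _ := h0
      _ ≤ C * (K * tailSum μ s a p H 0 y + 2 ^ n * K * tailSum μ s a p H 0 y) := by
          gcongr
          exact (hK y hyS).2.trans (mul_le_mul_right (awayMean_le_tailSum μ s a p H 0 y) _)
      _ = _ := by push_cast; ring
  · intro x hx i
    set r : ℝ := (1 / 2) ^ i with hr
    have hr0 : 0 < r := by positivity
    set V := ⨍⁻ y in cube x r, tailSum μ s a p H i y ∂μ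
    have hP : ∀ P ∈ polysBelow n k, localApprox μ k (trace f) x r ≤
        C * 2 ^ n * ⨍⁻ z in cube x (2 * r),
            ENNReal.ofReal |f z - MvPolynomial.eval (fun i => z i) P| ∂volume
          + C * (2 ^ n * K) * V := by
      intro P hP
      refine (localApprox_le hP).trans (setLAverage_le_add_mul (measurableSet_cube x r)
        (measurable_tailSum μ s a p hH i) ?_)
      filter_upwards [htrace] with y hy hyx
      refine (hy P hP i).trans ?_
      rw [mul_add, mul_assoc (C : ℝ≥0∞) (2 ^ n), mul_assoc (C : ℝ≥0∞) (2 ^ n * (K : ℝ≥0∞))]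
      gcongr
      have hc := setLAverage_cube_le
        (fun z : E n => ENNReal.ofReal |f z - MvPolynomial.eval (fun i => z i) P|) hr0
        (by positivity : 0 < 2 * r) (cube_subset_cube hyx (by linarith))
      rwa [mul_div_cancel_right₀ _ hr0.ne', ENNReal.ofReal_ofNat] at hc
    have hinf : localApprox μ k (trace f) x r - C * (2 ^ n * K) * V
        ≤ C * 2 ^ n * localApprox volume k f x (2 * r) :=
      le_mul_localApprox (by finiteness) fun P h => tsub_le_iff_right.2 (hP P h)
    calc _ ≤ C * 2 ^ n * localApprox volume k f x (2 * r) + C * (2 ^ n * K) * V :=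
          tsub_le_iff_right.1 hinf
      _ ≤ C * 2 ^ n * (K * tailSum μ s a p H i x) + C * (2 ^ n * K) * V := by
          gcongr
          exact ((hK x hx).1 i).trans (mul_le_mul_right (awayMean_le_tailSum μ s a p H i x) _)
      _ = C * (2 ^ n * K) * (tailSum μ s a p H i x + V) := by ring
      _ ≤ _ := by
          push_cast
          exact mul_le_mul_left le_self_add _

end Main

end TraceDSet

end

theorem theorem4p6 (n : ℕ) (d : ℝ) (hd : (n : ℝ) - 1 < d) (hdn : d < n)
    (S : Set (TraceDSet.E n)) (hS : TraceDSet.IsDSet d S)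
    (p : ℝ) (hp : 1 < p) (α : ℝ) (hα : ((n : ℝ) - d) / p < α)
    (m : ℕ) (hm : α < m) :
    ∃ c : ℝ≥0, ∀ (q : ℝ≥0∞), 1 ≤ q → ∀ k : ℕ, α < k → ∀ f : TraceDSet.E n → ℝ,
      TraceDSet.MemTriebelLizorkin m α p q f →
        (∀ᵐ x ∂(TraceDSet.measureOn d S), TraceDSet.StrictlyDefinedAt f x) ∧
        MemLp (TraceDSet.trace f) (ENNReal.ofReal p) (TraceDSet.measureOn d S) ∧
        (∑' i : ℕ,
            (ENNReal.ofReal ((2 : ℝ) ^ ((i : ℝ) * (α - ((n : ℝ) - d) / p))) *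
              eLpNorm
                (fun x => TraceDSet.localApprox (TraceDSet.measureOn d S) k
                  (TraceDSet.trace f) x ((2 : ℝ) ^ (-(i : ℝ))))
                (ENNReal.ofReal p) (TraceDSet.measureOn d S)) ^ p) ^ (1 / p) +
          eLpNorm (TraceDSet.trace f) (ENNReal.ofReal p) (TraceDSet.measureOn d S)
          ≤ (c : ℝ≥0∞) * TraceDSet.triebelLizorkinNorm m α p q f := by
  have hp0 : 0 < p := by linarith
  have hnd0 : 0 < ((n : ℝ) - d) / p := div_pos (by linarith) hp0
  have hα0 : 0 < α := hnd0.trans hα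
  have hγ : 0 < α * p - (n - d) := by rw [div_lt_iff₀ hp0] at hα; linarith
  have hd0 : 0 < d := hS.1
  obtain ⟨c₁, c₂, hreg⟩ := hS.exists_isRegular
  have hσ := hS.sigmaFinite
  -- Approximation of the lowest admissible order dominates that of every order `k > α`, so the
  -- constant does not depend on `k`.
  set k₀ : ℕ := ⌊α⌋₊ + 1 with hk₀
  have hαk₀ : α < k₀ := by exact_mod_cast Nat.lt_floor_add_one α
  have hk₀le : ∀ k : ℕ, α < k → k₀ ≤ k := fun k hk => (Nat.floor_lt hα0.le).2 hk
  obtain ⟨s, hs⟩ := hreg.exists_porosity hdn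
  obtain ⟨K, hK⟩ := TraceDSet.exists_le_awayMean hs (Nat.le_add_left 1 ⌊α⌋₊) (hk₀le m hm) hα0.le
    le_rfl hαk₀ hp0
  obtain ⟨K₁, hK₁⟩ := hreg.exists_tsum_lintegral_tailSum_le hd0 s hp hγ
  obtain ⟨K₂, hK₂⟩ := TraceDSet.exists_lintegral_majorant_le n hp
  obtain ⟨D, hD⟩ := TraceDSet.exists_trace_le n (Nat.le_add_left 1 ⌊α⌋₊) K
  set μ := TraceDSet.measureOn d S with hμ
  set R : ℝ≥0∞ := (D : ℝ≥0∞) ^ p * (2 ^ (p - 1) * (1 + ENNReal.ofReal (c₂ / c₁))) with hR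
  have hDtop : (D : ℝ≥0∞) ^ p ≠ ∞ := ENNReal.rpow_ne_top_of_nonneg hp0.le ENNReal.coe_ne_top
  have h2top : (2 : ℝ≥0∞) ^ (p - 1) ≠ ∞ :=
    ENNReal.rpow_ne_top_of_nonneg (by linarith) ENNReal.ofNat_ne_top
  have hRtop : R ≠ ∞ := by
    refine ENNReal.mul_ne_top hDtop (ENNReal.mul_ne_top h2top (by finiteness))
  have hA : (R * (K₁ * K₂)) ^ (1 / p) ≠ ∞ :=
    ENNReal.rpow_ne_top_of_nonneg (by positivity) (ENNReal.mul_ne_top hRtop (by finiteness))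
  have hB : ((D : ℝ≥0∞) ^ p * (K₁ * K₂)) ^ (1 / p) ≠ ∞ :=
    ENNReal.rpow_ne_top_of_nonneg (by positivity) (ENNReal.mul_ne_top hDtop (by finiteness))
  refine ⟨((R * (K₁ * K₂)) ^ (1 / p) + ((D : ℝ≥0∞) ^ p * (K₁ * K₂)) ^ (1 / p)).toNNReal,
    fun q hq k hk f hf => ?_⟩
  rw [ENNReal.coe_toNNReal (ENNReal.add_ne_top.2 ⟨hA, hB⟩)]
  have hex : ∀ᵐ x ∂μ, TraceDSet.StrictlyDefinedAt f x :=
    hreg.ae_strictlyDefinedAt hd0 hdn hd hp hα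
      ((Nat.le_add_left 1 ⌊α⌋₊).trans (hk₀le m hm)) hq hf
  have hfm := hf.1.aestronglyMeasurable
  have hloc : LocallyIntegrable f volume := hf.1.locallyIntegrable (by simpa using hp.le)
  have hHm := TraceDSet.aemeasurable_majorant hfm hf.2.aestronglyMeasurable
  have hH := hHm.measurable_mk
  set H := hHm.mk _
  obtain ⟨htr, happ⟩ := hD S μ hreg.null_compl s α p f H hH hloc hex
    (hK q hq f hfm.aemeasurable H hH hHm.ae_eq_mk)
  set N := TraceDSet.triebelLizorkinNorm m α p q f with hN
  have hNtop : N ≠ ∞ := ENNReal.add_ne_top.2 ⟨hf.1.eLpNorm_ne_top, hf.2.eLpNorm_ne_top⟩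
  have hU : ∀ i : ℕ, Measurable (TraceDSet.tailSum μ s α p H i) :=
    TraceDSet.measurable_tailSum μ s α p hH
  have hsum : ∑' i : ℕ, ENNReal.ofReal (2 ^ (i * (α * p - (n - d)))) *
      ∫⁻ y, TraceDSet.tailSum μ s α p H i y ^ p ∂μ ≤ K₁ * K₂ * N ^ p := by
    refine (hK₁ H hH).trans ?_
    rw [mul_assoc, ← lintegral_congr_ae (hHm.ae_eq_mk.mono fun y hy => congrArg (· ^ p) hy)]
    exact mul_le_mul_right (hK₂ m α q f hf) _
  have hroot : ∀ {b v : ℝ≥0∞}, v ≤ b * (K₁ * K₂ * N ^ p) →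
      v ^ (1 / p) ≤ (b * (K₁ * K₂)) ^ (1 / p) * N := by
    intro b v hv
    refine (ENNReal.rpow_le_rpow hv (z := 1 / p) (by positivity)).trans_eq ?_
    rw [← mul_assoc, ENNReal.mul_rpow_of_nonneg _ _ (by positivity), ← ENNReal.rpow_mul,
      mul_one_div_cancel hp0.ne', ENNReal.rpow_one]
  have htrace : eLpNorm (TraceDSet.trace f) (ENNReal.ofReal p) μ
      ≤ ((D : ℝ≥0∞) ^ p * (K₁ * K₂)) ^ (1 / p) * N := by
    have h1 : eLpNorm (TraceDSet.trace f) (ENNReal.ofReal p) μ ^ p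
        ≤ (D : ℝ≥0∞) ^ p * (K₁ * K₂ * N ^ p) := by
      rw [TraceDSet.eLpNorm_ofReal_rpow hp0]
      calc _ ≤ ∫⁻ y, (D : ℝ≥0∞) ^ p * TraceDSet.tailSum μ s α p H 0 y ^ p ∂μ := by
            refine lintegral_mono_ae ?_
            filter_upwards [htr] with y hy
            rw [Real.enorm_eq_ofReal_abs, ← ENNReal.mul_rpow_of_nonneg _ _ hp0.le]
            exact ENNReal.rpow_le_rpow hy hp0.le
        _ = (D : ℝ≥0∞) ^ p * ∫⁻ y, TraceDSet.tailSum μ s α p H 0 y ^ p ∂μ :=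
            lintegral_const_mul _ ((hU 0).pow_const p)
        _ ≤ _ := by
            refine mul_le_mul_right (le_trans ?_ hsum) _
            refine le_trans (le_of_eq ?_) (ENNReal.le_tsum 0)
            simp
    have h2 := hroot h1
    rwa [← ENNReal.rpow_mul, mul_one_div_cancel hp0.ne', ENNReal.rpow_one] at h2
  refine ⟨hex, ⟨(TraceDSet.aemeasurable_trace hfm hex).aestronglyMeasurable,
    htrace.trans_lt (ENNReal.mul_lt_top hB.lt_top hNtop.lt_top)⟩, ?_⟩
  rw [add_mul]
  refine add_le_add (hroot ?_) htrace
  have hSae : ∀ᵐ x ∂μ, x ∈ S := hreg.null_compl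
  have hterm : ∀ i : ℕ, (ENNReal.ofReal ((2 : ℝ) ^ ((i : ℝ) * (α - ((n : ℝ) - d) / p))) *
      eLpNorm (fun x => TraceDSet.localApprox μ k (TraceDSet.trace f) x ((2 : ℝ) ^ (-(i : ℝ))))
        (ENNReal.ofReal p) μ) ^ p
      ≤ R * (ENNReal.ofReal (2 ^ (i * (α * p - (n - d)))) *
        ∫⁻ y, TraceDSet.tailSum μ s α p H i y ^ p ∂μ) := by
    intro i
    have hr : (2 : ℝ) ^ (-(i : ℝ)) = (1 / 2) ^ i := by
      rw [Real.rpow_neg two_pos.le, Real.rpow_natCast, one_div, inv_pow]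
    have hint : ∫⁻ x, TraceDSet.localApprox μ k (TraceDSet.trace f) x ((1 / 2) ^ i) ^ p ∂μ
        ≤ R * ∫⁻ y, TraceDSet.tailSum μ s α p H i y ^ p ∂μ := by
      calc _ ≤ ∫⁻ x, (D : ℝ≥0∞) ^ p * (2 ^ (p - 1) * (TraceDSet.tailSum μ s α p H i x ^ p
            + (⨍⁻ y in TraceDSet.cube x ((1 / 2) ^ i), TraceDSet.tailSum μ s α p H i y ∂μ) ^ p))
              ∂μ := by
            refine lintegral_mono_ae ?_
            filter_upwards [hSae] with x hx
            refine (ENNReal.rpow_le_rpow ((TraceDSet.localApprox_antitone μ _ x _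
              (hk₀le k hk)).trans (happ x hx i)) hp0.le).trans ?_
            rw [ENNReal.mul_rpow_of_nonneg _ _ hp0.le]
            exact mul_le_mul_right (ENNReal.rpow_add_le_mul_rpow_add_rpow _ _ hp.le) _
        _ = (D : ℝ≥0∞) ^ p * (2 ^ (p - 1) * ((∫⁻ x, TraceDSet.tailSum μ s α p H i x ^ p ∂μ)
            + ∫⁻ x, (⨍⁻ y in TraceDSet.cube x ((1 / 2) ^ i),
              TraceDSet.tailSum μ s α p H i y ∂μ) ^ p ∂μ)) := by
            rw [lintegral_const_mul' _ _ hDtop, lintegral_const_mul' _ _ h2top,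
              lintegral_add_left ((hU i).pow_const p)]
        _ ≤ (D : ℝ≥0∞) ^ p * (2 ^ (p - 1) * ((∫⁻ x, TraceDSet.tailSum μ s α p H i x ^ p ∂μ)
            + ENNReal.ofReal (c₂ / c₁) * ∫⁻ x, TraceDSet.tailSum μ s α p H i x ^ p ∂μ)) := by
            gcongr
            exact hreg.lintegral_setLAverage_rpow_le (hU i) hp (by positivity)
              (pow_le_one₀ (by norm_num) (by norm_num))
        _ = _ := by rw [hR]; ring
    rw [ENNReal.mul_rpow_of_nonneg _ _ hp0.le, TraceDSet.eLpNorm_ofReal_rpow hp0,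
      ENNReal.ofReal_rpow_of_pos (by positivity), ← Real.rpow_mul two_pos.le]
    simp only [enorm_eq_self, hr]
    rw [show (i : ℝ) * (α - ((n : ℝ) - d) / p) * p = i * (α * p - (n - d)) by field_simp]
    calc _ ≤ _ := mul_le_mul_right hint _
      _ = _ := by ring
  calc _ ≤ ∑' i : ℕ, R * (ENNReal.ofReal (2 ^ (i * (α * p - (n - d)))) *
        ∫⁻ y, TraceDSet.tailSum μ s α p H i y ^ p ∂μ) := ENNReal.tsum_le_tsum hterm
    _ ≤ _ := by rw [ENNReal.tsum_mul_left]; exact mul_le_mul_right hsum _
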